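/- Let $N\ge 1$ and $0<b<\min\{2,N\}$, and consider the $L^2$-critical inhomogeneous nonlinear Schrödinger equation $$i\partial_t u+\Delta u+|x|^{-b}|u|^{\frac{4-2b}{N}}u=0,\qquad x\in\mathbb R^N. \tag{1}$$ A solution of (1) on an open interval $J\subset\mathbb R$ is a function $u\in C(J;H^1(\mathbb R^N))$ which satisfies (1) at every time $t\in J$ in the sense of distributions on $\mathbb R^N$. That is, $|x|^{-b}|u(t)|^{\frac{4-2b}{N}}u(t)$ is locally integrable for every $t\in J$ and, for every $\eta\in C_c^\infty(\mathbb R^N;\mathbb C)$, the function $t\mapsto\int u(t)\eta\,dx$ is differentiable on $J$ with $$i\frac{d}{dt}\int u(t)\eta\,dx+\int u(t)\Delta\eta\,dx+\int|x|^{-b}|u(t)|^{\frac{4-2b}{N}}u(t)\eta\,dx=0 .$$ Let $\psi\in H^1(\mathbb R^N)$ be the ground state, i.e. the positive radial solution (in the sense of distributions, the nonlinear term being locally integrable) of $$\Delta\psi-\psi+|x|^{-b}|\psi|^{\frac{4-2b}{N}}\psi=0 .$$ Then for all $T\in\mathbb R$, $\lambda_0>0$ and $\gamma_0\in\mathbb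 R$, the function $$S_{T,\lambda_0,\gamma_0}(t,x)=e^{i\gamma_0}\,e^{i\frac{\lambda_0^2}{T-t}}\,e^{-i\frac{|x|^2}{4(T-t)}}\Big(\frac{\lambda_0}{T-t}\Big)^{N/2}\psi\Big(\frac{\lambda_0x}{T-t}\Big),\qquad t<T,\ x\in\mathbb R^N,$$ is a solution of (1) on $(-\infty,T)$ of critical mass, i.e. $\|S_{T,\lambda_0,\gamma_0}(t)\|_{L^2}=\|\psi\|_{L^2}$ for all $t<T$, and it blows up at time $T$ with speed $$\|\nabla S_{T,\lambda_0,\gamma_0}(t)\|_{L^2}\sim\frac{C}{T-t}\quad\text{as }t\uparrow T$$ for some constant $C>0$ (i.e. the ratio of the two sides tends to $1$). -/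

import Mathlib

open MeasureTheory Filter Topology Asymptotics
open scoped ContDiff

namespace INLS

noncomputable section

/-- `ℝ^N` with its Euclidean norm and Lebesgue measure. -/
abbrev Space (N : ℕ) : Type := EuclideanSpace ℝ (Fin N)

/-- Test functions: complex-valued, smooth and compactly supported. -/
def IsTestFunction {N : ℕ} (η : Space N → ℂ) : Prop :=
  ContDiff ℝ ∞ η ∧ HasCompactSupport η

/-- `g` is the gradient of `u` in the sense of distributions:
`∫ u ∂ᵢη = - ∫ gᵢ η` for every test function `η` and every coordinate `i`. -/
def HasWeakGradient {N : ℕ} (u : Space N → ℂ) (g : Space N → EuclideanSpace ℂ (Fin N)) : Prop :=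
  ∀ η : Space N → ℂ, IsTestFunction η → ∀ i : Fin N,
    ∫ x, u x * fderiv ℝ η x (EuclideanSpace.single i 1) = -∫ x, g x i * η x

/-- The Sobolev space `H¹(ℝ^N; ℂ)`: `u ∈ L²` with distributional gradient in `L²`. -/
def MemH1 {N : ℕ} (u : Space N → ℂ) : Prop :=
  MemLp u 2 volume ∧ ∃ g : Space N → EuclideanSpace ℂ (Fin N),
    MemLp g 2 volume ∧ HasWeakGradient u g

open Classical in
/-- The distributional gradient `∇u` of `u ∈ H¹` (determined almost everywhere;
`0` by convention if `u ∉ H¹`). -/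
def weakGrad {N : ℕ} (u : Space N → ℂ) : Space N → EuclideanSpace ℂ (Fin N) :=
  if h : MemH1 u then h.2.choose else 0

/-- The norm `‖f‖_{L²(ℝ^N)}` as a real number. -/
def l2Norm {N : ℕ} {F : Type*} [NormedAddCommGroup F] (f : Space N → F) : ℝ :=
  (eLpNorm f 2 volume).toReal

/-- The norm `‖u‖_{H¹} = (‖u‖₂² + ‖∇u‖₂²)^{1/2}`. -/
def h1Norm {N : ℕ} (u : Space N → ℂ) : ℝ :=
  Real.sqrt (l2Norm u ^ 2 + l2Norm (weakGrad u) ^ 2)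

/-- The nonlinearity `|x|^{-b} |u|^{(4-2b)/N} u`. -/
def nonlin {N : ℕ} (b : ℝ) (u : Space N → ℂ) (x : Space N) : ℂ :=
  ((‖x‖ ^ (-b) * ‖u x‖ ^ ((4 - 2 * b) / (N : ℝ)) : ℝ) : ℂ) * u x

/-- `u` is a strong `H¹` solution of `i ∂ₜu + Δu + |x|^{-b}|u|^{(4-2b)/N} u = 0` on the time
interval `J`: `u ∈ C(J; H¹(ℝ^N))`, and the equation holds at every time `t ∈ J` in the sense of
distributions on `ℝ^N`, i.e. for every test function `η`,
`i d/dt ∫ u(t) η + ∫ u(t) Δη + ∫ |x|^{-b}|u(t)|^{(4-2b)/N} u(t) η = 0`. -/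
structure IsSolutionOn {N : ℕ} (b : ℝ) (J : Set ℝ) (u : ℝ → Space N → ℂ) : Prop where
  memH1 : ∀ t ∈ J, MemH1 (u t)
  continuous_h1 : ∀ t ∈ J, Tendsto (fun s => h1Norm (u s - u t)) (𝓝[J] t) (𝓝 0)
  locallyIntegrable_nonlin : ∀ t ∈ J, LocallyIntegrable (nonlin b (u t)) volume
  equation : ∀ η : Space N → ℂ, IsTestFunction η → ∀ t ∈ J, ∃ d : ℂ,
    HasDerivWithinAt (fun s => ∫ x, u s x * η x) d J t ∧
    Complex.I * d + (∫ x, u t x * Laplacian.laplacian η x) + (∫ x, nonlin b (u t) x * η x) = 0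

/-- `ψ` is a ground state: a positive radial function in `H¹(ℝ^N)` that solves
`Δψ - ψ + |x|^{-b}|ψ|^{(4-2b)/N} ψ = 0` in the sense of distributions. -/
structure IsGroundState {N : ℕ} (b : ℝ) (ψ : Space N → ℝ) : Prop where
  pos : ∀ x, 0 < ψ x
  radial : ∀ x y, ‖x‖ = ‖y‖ → ψ x = ψ y
  memH1 : MemH1 (fun x => (ψ x : ℂ))
  locallyIntegrable_nonlin : LocallyIntegrable (nonlin b (fun x => (ψ x : ℂ))) volume
  equation : ∀ η : Space N → ℂ, IsTestFunction η →
    (∫ x, (ψ x : ℂ) * Laplacian.laplacian η x) - (∫ x, (ψ x : ℂ) * η x)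
      + (∫ x, nonlin b (fun x => (ψ x : ℂ)) x * η x) = 0

/-- `S_{T,λ₀,γ₀}(t,x) = e^{iγ₀} e^{iλ₀²/(T-t)} e^{-i|x|²/(4(T-t))} (λ₀/(T-t))^{N/2} ψ(λ₀x/(T-t))`
(used for `t < T`). -/
def S {N : ℕ} (ψ : Space N → ℝ) (T lam0 gam0 : ℝ) (t : ℝ) (x : Space N) : ℂ :=
  Complex.exp (Complex.I * (gam0 : ℂ))
    * Complex.exp (Complex.I * ((lam0 ^ 2 / (T - t) : ℝ) : ℂ))
    * Complex.exp (-(Complex.I * ((‖x‖ ^ 2 / (4 * (T - t)) : ℝ) : ℂ)))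
    * (((lam0 / (T - t)) ^ ((N : ℝ) / 2) : ℝ) : ℂ)
    * (ψ ((lam0 / (T - t)) • x) : ℂ)

end

end INLS

/-! Write `τ = T - t` and `a = λ₀/τ`. The function `S` is the pseudoconformal image of the standing
wave `e^{it}ψ`, and the L²-critical exponent makes that transformation a symmetry of the equation.
As `ψ` is only in H¹, the symmetry is verified on the test function instead. Substituting `y = a x`
gives `∫ S(t) η = ∫ ψ Φ[η]`, where `Φ[η]` (`pullback`) is a test function carrying all the time
dependence. The pointwise identity `-i ∂_τ Φ[η] + Φ[Δη] = a² (ΔΦ[η] - Φ[η])` (`pullback_identity`)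
and the scaling of the nonlinearity by the same `a²` (`nonlin_S`) turn the equation for `S` tested
on `η` into `a²` times the ground state equation tested on `Φ[η]`.

Multiplication by the chirp after dilation is an L² isometry, whence the critical mass. The gradient
of `S` is the isometric image of `a ∇ψ - (i/2λ₀) y ψ`. Once `y ψ` is in L², this gives H¹ membership
and continuity, and the gradient norm stays within a bounded distance of `a ‖∇ψ‖`. So the blow-up
constant is `λ₀ ‖∇ψ‖`, positive by `IsGroundState.l2Norm_gradient_pos`.

The analytic core is `y ψ ∈ L²` (`IsGroundState.memLp_firstMoment`), obtained from the weak equation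
without regularity theory. A radial H¹ function is essentially bounded away from the origin, so `V =
|x|^{-b} ψ^{(4-2b)/N}` tends to zero at infinity. Testing `Δψ = (1 - V)ψ` with a cutoff at scale `ρ`
bounds the integral of the positive function `ψ` over a dyadic annulus by `K ρ^{-2}` times its
integrals over that annulus and its two neighbours. Iteration gives polynomial decay, and `ψ² ≤ Cψ`
makes the second moment summable over dyadic annuli. -/

namespace INLS

variable {N : ℕ}

/-! ### Test functions and their Laplacians -/

section TestFunctions

theorem IsTestFunction.continuous {η : Space N → ℂ} (h : IsTestFunction η) : Continuous η :=
  h.1.continuous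

theorem IsTestFunction.mul_left {η P : Space N → ℂ} (h : IsTestFunction η)
    (hP : ContDiff ℝ ∞ P) : IsTestFunction (fun x => P x * η x) :=
  ⟨hP.mul h.1, h.2.mul_left⟩

theorem IsTestFunction.comp_smul {η : Space N → ℂ} (h : IsTestFunction η) {a : ℝ} (ha : a ≠ 0) :
    IsTestFunction (fun x => η (a • x)) :=
  ⟨h.1.comp (contDiff_const_smul a), h.2.comp_smul ha⟩

theorem IsTestFunction.fderiv_apply {η : Space N → ℂ} (h : IsTestFunction η) (v : Space N) :
    IsTestFunction (fun x => fderiv ℝ η x v) :=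
  ⟨(h.1.fderiv_right (m := ∞) (by simp)).clm_apply contDiff_const, h.2.fderiv_apply ℝ v⟩

theorem isTestFunction_ofReal {θ : Space N → ℝ} (h : ContDiff ℝ ∞ θ) (hc : HasCompactSupport θ) :
    IsTestFunction (fun x => (θ x : ℂ)) :=
  ⟨Complex.ofRealCLM.contDiff.comp h, hc.comp_left (g := fun r : ℝ => (r : ℂ)) Complex.ofReal_zero⟩

theorem laplacian_eq_sum {E : Type*} [NormedAddCommGroup E] [NormedSpace ℝ E]
    {η : Space N → E} (h : ContDiff ℝ 2 η) (x : Space N) :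
    Laplacian.laplacian η x = ∑ i : Fin N,
      fderiv ℝ (fun y => fderiv ℝ η y (EuclideanSpace.single i 1)) x
        (EuclideanSpace.single i 1) := by
  rw [InnerProductSpace.laplacian_eq_iteratedFDeriv_orthonormalBasis η
    (EuclideanSpace.basisFun (Fin N) ℝ)]
  refine Finset.sum_congr rfl fun i _ => ?_
  rw [iteratedFDeriv_two_apply]
  have hd : DifferentiableAt ℝ (fderiv ℝ η) x :=
    ((h.fderiv_right (m := 1) (by norm_num)).differentiable (by norm_num)) x
  rw [fderiv_clm_apply hd (differentiableAt_const _)]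
  simp

theorem IsTestFunction.laplacian {η : Space N → ℂ} (h : IsTestFunction η) :
    IsTestFunction (Laplacian.laplacian η) := by
  have : Laplacian.laplacian η = fun x => ∑ i : Fin N,
      fderiv ℝ (fun y => fderiv ℝ η y (EuclideanSpace.single i 1)) x
        (EuclideanSpace.single i 1) :=
    funext fun x => laplacian_eq_sum (contDiff_infty.1 h.1 2) x
  rw [this]
  refine ⟨ContDiff.sum fun i _ => ((h.fderiv_apply _).fderiv_apply _).1, ?_⟩
  have : ∀ s : Finset (Fin N), HasCompactSupport (fun x => ∑ i ∈ s,
      fderiv ℝ (fun y => fderiv ℝ η y (EuclideanSpace.single i 1)) x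
        (EuclideanSpace.single i 1)) := by
    intro s
    classical
    induction s using Finset.induction_on with
    | empty => simpa using! HasCompactSupport.zero
    | insert i s hi ih =>
      simp only [Finset.sum_insert hi]
      exact ((h.fderiv_apply _).fderiv_apply _).2.add ih
  exact this _

theorem integrable_mul_test {u η : Space N → ℂ} (hu : LocallyIntegrable u volume)
    (h : IsTestFunction η) : Integrable (fun x => u x * η x) volume := by
  simpa [mul_comm] using hu.integrable_smul_left_of_hasCompactSupport h.continuous h.2

end TestFunctions

/-! ### Dilations in L² -/

section Scaling

variable {E : Type*} [NormedAddCommGroup E]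

theorem eLpNorm_comp_smul (F : Space N → E) {a : ℝ} (ha : 0 < a) :
    eLpNorm (fun x => F (a • x)) 2 volume
      = ENNReal.ofReal (a ^ (-((N : ℝ) / 2))) * eLpNorm F 2 volume := by
  have hme : MeasurableEmbedding (fun x : Space N => a • x) :=
    (Homeomorph.smulOfNeZero a ha.ne').measurableEmbedding
  have h1 := hme.eLpNorm_map_measure (p := 2) (g := F) (μ := volume)
  have h2 : eLpNorm (F ∘ (fun x : Space N => a • x)) 2 volume
      = eLpNorm (fun x => F (a • x)) 2 volume := rfl
  rw [← h2, ← h1, Measure.map_addHaar_smul volume ha.ne',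
    eLpNorm_smul_measure_of_ne_top (by simp)]
  rw [smul_eq_mul, finrank_euclideanSpace, Fintype.card_fin]
  congr 1
  rw [abs_of_pos (by positivity), ENNReal.ofReal_rpow_of_pos (by positivity)]
  congr 1
  rw [← Real.rpow_natCast, ← Real.rpow_neg ha.le, ← Real.rpow_mul ha.le]
  congr 1
  simp
  ring

theorem memLp_comp_smul {F : Space N → E} (hF : MemLp F 2 volume) {a : ℝ} (ha : 0 < a) :
    MemLp (fun x => F (a • x)) 2 volume := by
  refine ⟨hF.1.comp_quasiMeasurePreserving (Measure.quasiMeasurePreserving_smul volume ha.ne'), ?_⟩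
  rw [eLpNorm_comp_smul F ha]
  exact ENNReal.mul_lt_top ENNReal.ofReal_lt_top hF.2

theorem locallyIntegrable_comp_smul {F : Space N → E} (hF : LocallyIntegrable F volume) {a : ℝ}
    (ha : 0 < a) : LocallyIntegrable (fun x => F (a • x)) volume := by
  refine (locallyIntegrable_map_homeomorph (Homeomorph.smulOfNeZero a ha.ne')
    (f := F) (μ := (volume : Measure (Space N)))).1 ?_
  have : Measure.map (Homeomorph.smulOfNeZero a ha.ne') (volume : Measure (Space N))
      = Measure.map (fun x => a • x) volume := rfl
  rw [this, Measure.map_addHaar_smul volume ha.ne']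
  intro x
  obtain ⟨s, hs, h⟩ := hF x
  refine ⟨s, hs, ?_⟩
  rw [IntegrableOn, Measure.restrict_smul]
  exact Integrable.smul_measure h ENNReal.ofReal_ne_top

end Scaling

/-! ### Calculus of weak gradients -/

section WeakGradient

theorem locallyIntegrable_of_memLp_two {E : Type*} [NormedAddCommGroup E] {F : Space N → E}
    (hF : MemLp F 2 volume) : LocallyIntegrable F volume :=
  hF.locallyIntegrable (by norm_num)

theorem locallyIntegrable_coord {g : Space N → EuclideanSpace ℂ (Fin N)}
    (hg : LocallyIntegrable g volume) (i : Fin N) :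
    LocallyIntegrable (fun x => g x i) volume := by
  intro x
  obtain ⟨s, hs, h⟩ := hg x
  exact ⟨s, hs, (EuclideanSpace.proj (𝕜 := ℂ) i).integrable_comp h⟩

theorem HasWeakGradient.unique {u : Space N → ℂ} {g g' : Space N → EuclideanSpace ℂ (Fin N)}
    (hg : LocallyIntegrable g volume) (hg' : LocallyIntegrable g' volume)
    (h : HasWeakGradient u g) (h' : HasWeakGradient u g') : g =ᵐ[volume] g' := by
  have key : ∀ i : Fin N, ∀ᵐ x, g x i = g' x i := by
    intro i
    refine ae_eq_of_integral_contDiff_smul_eq (locallyIntegrable_coord hg i)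
      (locallyIntegrable_coord hg' i) fun θ hθ hc => ?_
    have := (h _ (isTestFunction_ofReal hθ hc) i).symm.trans (h' _ (isTestFunction_ofReal hθ hc) i)
    simpa [mul_comm] using this
  filter_upwards [ae_all_iff.2 key] with x hx
  ext i
  exact hx i

/-- `weakGrad` is an arbitrary choice; almost everywhere uniqueness lets its norm be computed from
any explicit weak gradient. -/
theorem l2Norm_weakGrad {u : Space N → ℂ} {g : Space N → EuclideanSpace ℂ (Fin N)}
    (hu : MemLp u 2 volume) (hg : MemLp g 2 volume) (h : HasWeakGradient u g) :
    l2Norm (weakGrad u) = l2Norm g := by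
  have hH : MemH1 u := ⟨hu, g, hg, h⟩
  have : weakGrad u = hH.2.choose := by simp [weakGrad, hH]
  rw [this]
  unfold l2Norm
  rw [eLpNorm_congr_ae (HasWeakGradient.unique
    (locallyIntegrable_of_memLp_two hH.2.choose_spec.1) (locallyIntegrable_of_memLp_two hg) hH.2.choose_spec.2 h)]

theorem HasWeakGradient.sub {u v : Space N → ℂ} {g g' : Space N → EuclideanSpace ℂ (Fin N)}
    (hu : LocallyIntegrable u volume) (hv : LocallyIntegrable v volume)
    (hg : LocallyIntegrable g volume) (hg' : LocallyIntegrable g' volume)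
    (h : HasWeakGradient u g) (h' : HasWeakGradient v g') : HasWeakGradient (u - v) (g - g') := by
  intro η hη i
  have h1 := integrable_mul_test hu (hη.fderiv_apply (EuclideanSpace.single i 1))
  have h2 := integrable_mul_test hv (hη.fderiv_apply (EuclideanSpace.single i 1))
  have h3 := integrable_mul_test (locallyIntegrable_coord hg i) hη
  have h4 := integrable_mul_test (locallyIntegrable_coord hg' i) hη
  have e1 : ∀ x, (u - v) x * fderiv ℝ η x (EuclideanSpace.single i 1)
      = u x * fderiv ℝ η x (EuclideanSpace.single i 1)
        - v x * fderiv ℝ η x (EuclideanSpace.single i 1) := fun x => by simp [sub_mul]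
  have e2 : ∀ x, (g - g') x i * η x = g x i * η x - g' x i * η x := fun x => by simp [sub_mul]
  simp only [e1, e2]
  rw [integral_sub h1 h2, integral_sub h3 h4, h η hη i, h' η hη i]
  ring

/-- Testing against `P η` and using the product rule suffices. No growth condition on `P` is needed
because `η` has compact support; this admits the quadratic phase, whose gradient is unbounded. -/
theorem HasWeakGradient.mul_smooth {u P : Space N → ℂ} {g : Space N → EuclideanSpace ℂ (Fin N)}
    (hu : LocallyIntegrable u volume) (hg : LocallyIntegrable g volume)
    (h : HasWeakGradient u g) (hP : ContDiff ℝ ∞ P) :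
    HasWeakGradient (fun x => P x * u x) (fun x => P x • g x
      + WithLp.toLp 2 (fun i => fderiv ℝ P x (EuclideanSpace.single i 1) * u x)) := by
  intro η hη i
  set e : Space N := EuclideanSpace.single i 1
  have hPd : ∀ x, DifferentiableAt ℝ P x := fun x => hP.differentiable (by simp) x
  have hηd : ∀ x, DifferentiableAt ℝ η x := fun x => hη.1.differentiable (by simp) x
  have hP' : ContDiff ℝ ∞ (fun x => fderiv ℝ P x e) :=
    (hP.fderiv_right (m := ∞) (by simp)).clm_apply contDiff_const
  have h1 := integrable_mul_test hu ((hη.mul_left hP).fderiv_apply e)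
  have h2 := integrable_mul_test hu (hη.mul_left hP')
  have h3 := integrable_mul_test (locallyIntegrable_coord hg i) (hη.mul_left hP)
  have e0 : ∀ x, fderiv ℝ (fun x => P x * η x) x e
      = P x * fderiv ℝ η x e + fderiv ℝ P x e * η x := by
    intro x
    rw [fderiv_fun_mul (hPd x) (hηd x)]
    simp
    ring
  have e1 : ∀ x, P x * u x * fderiv ℝ η x e
      = u x * fderiv ℝ (fun x => P x * η x) x e - u x * (fderiv ℝ P x e * η x) := by
    intro x
    rw [e0]; ring
  have e2 : ∀ x, (P x • g x
      + WithLp.toLp 2 (fun i => fderiv ℝ P x (EuclideanSpace.single i 1) * u x)) i * η x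
      = g x i * (P x * η x) + u x * (fderiv ℝ P x e * η x) := by
    intro x
    simp [e]; ring
  simp only [e1, e2]
  rw [integral_sub h1 h2, integral_add h3 h2, h _ (hη.mul_left hP) i]
  ring

theorem HasWeakGradient.comp_smul {u : Space N → ℂ} {g : Space N → EuclideanSpace ℂ (Fin N)}
    (h : HasWeakGradient u g) {a : ℝ} (ha : 0 < a) :
    HasWeakGradient (fun x => u (a • x)) (fun x => (a : ℂ) • g (a • x)) := by
  intro η hη i
  set e : Space N := EuclideanSpace.single i 1
  have hη' := hη.comp_smul (inv_ne_zero ha.ne')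
  have key := h _ hη' i
  have e0 : ∀ y, fderiv ℝ (fun x => η (a⁻¹ • x)) y e = (a⁻¹ : ℂ) * fderiv ℝ η (a⁻¹ • y) e := by
    intro y
    rw [fderiv_comp_smul]
    simp
  have s1 := Measure.integral_comp_smul (volume : Measure (Space N))
    (fun y => u y * fderiv ℝ η (a⁻¹ • y) e) a
  have s2 := Measure.integral_comp_smul (volume : Measure (Space N))
    (fun y => g y i * η (a⁻¹ • y)) a
  simp only [inv_smul_smul₀ ha.ne'] at s1 s2
  have e2 : ∀ x, ((a : ℂ) • g (a • x)) i * η x = (a : ℂ) * (g (a • x) i * η x) := by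
    intro x; simp; ring
  simp only [e2]
  rw [integral_const_mul, s1, s2]
  have k2 : ∫ y, u y * fderiv ℝ η (a⁻¹ • y) e
      = (a : ℂ) * ∫ y, u y * fderiv ℝ (fun x => η (a⁻¹ • x)) y e := by
    rw [← integral_const_mul]
    congr 1; ext y
    rw [e0]
    have : (a : ℂ) ≠ 0 := by exact_mod_cast ha.ne'
    field_simp
  rw [k2, key]
  simp only [Complex.real_smul]
  ring

end WeakGradient

/-! ### Strong continuity of modulated dilations in L² -/

section Continuity

variable {E : Type*} [NormedAddCommGroup E] [NormedSpace ℂ E]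

theorem tendsto_eLpNorm_modulation_of_hasCompactSupport {φ : Space N → E} (hφ : Continuous φ)
    (hc : HasCompactSupport φ) {m : ℝ → Space N → ℂ} {a : ℝ → ℝ} {t C : ℝ}
    (ha : ContinuousAt a t) (hat : 0 < a t) (hb : ∀ᶠ s in 𝓝 t, ∀ x, ‖m s x‖ ≤ C)
    (hm : ∀ x, ContinuousAt (fun s => m s x) t) (hmc : ∀ s, Continuous (m s)) :
    Tendsto (fun s => eLpNorm (fun x => m s x • φ (a s • x) - m t x • φ (a t • x)) 2 volume)
      (𝓝 t) (𝓝 0) := by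
  obtain ⟨M, hM⟩ := hφ.bounded_above_of_compact_support hc
  obtain ⟨R, hR⟩ := hc.isCompact.isBounded.subset_closedBall (0 : Space N)
  have hzero : ∀ y : Space N, R < ‖y‖ → φ y = 0 := by
    intro y hy
    by_contra h
    have := hR (subset_tsupport _ h)
    simp at this
    linarith
  have hC : 0 ≤ C := (norm_nonneg _).trans (hb.self_of_nhds 0)
  have hM0 : 0 ≤ M := (norm_nonneg _).trans (hM 0)
  have key : Tendsto (fun s => ∫⁻ x, ‖m s x • φ (a s • x) - m t x • φ (a t • x)‖ₑ ^ (2 : ℝ)) (𝓝 t)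
      (𝓝 (∫⁻ _x : Space N, 0)) := by
    refine tendsto_lintegral_filter_of_dominated_convergence
      -- For `s` near `t` one has `a s > a t / 2`, so outside this ball both dilates of `φ` are
      -- evaluated beyond radius `R` and vanish.
      ((Metric.closedBall (0 : Space N) (2 * R / a t)).indicator
        (fun _ => ENNReal.ofReal (2 * (C * M)) ^ (2 : ℝ))) ?_ ?_ ?_ ?_
    · refine Eventually.of_forall fun s => Continuous.measurable ?_
      have := hmc s
      have := hmc t
      fun_prop
    · filter_upwards [hb, ha.eventually (lt_mem_nhds (half_lt_self hat))] with s hs has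
      refine Eventually.of_forall fun x => ?_
      by_cases hx : x ∈ Metric.closedBall (0 : Space N) (2 * R / a t)
      · rw [Set.indicator_of_mem hx]
        gcongr
        rw [← ofReal_norm]
        apply ENNReal.ofReal_le_ofReal
        refine (norm_sub_le _ _).trans ?_
        rw [norm_smul, norm_smul]
        have h1 := mul_le_mul (hs x) (hM (a s • x)) (norm_nonneg _) hC
        have h2 := mul_le_mul (hb.self_of_nhds x) (hM (a t • x)) (norm_nonneg _) hC
        linarith
      · rw [Set.indicator_of_notMem hx]
        simp only [Metric.mem_closedBall, dist_zero_right, not_le] at hx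
        rw [div_lt_iff₀ hat] at hx
        have hx0 := norm_nonneg x
        have e1 : φ (a s • x) = 0 := by
          apply hzero
          rw [norm_smul, Real.norm_of_nonneg (by linarith)]
          nlinarith
        have e2 : φ (a t • x) = 0 := by
          by_cases hR0 : 0 ≤ R
          · apply hzero
            rw [norm_smul, Real.norm_of_nonneg hat.le]
            nlinarith
          · exact hzero _ (by linarith [norm_nonneg (a t • x)])
        simp [e1, e2]
    · rw [lintegral_indicator Metric.isClosed_closedBall.measurableSet, setLIntegral_const]
      refine ENNReal.mul_ne_top (by finiteness) ?_
      exact (isCompact_closedBall _ _).measure_lt_top.ne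
    · refine Eventually.of_forall fun x => ?_
      have h1 : ContinuousAt (fun s => m s x • φ (a s • x) - m t x • φ (a t • x)) t := by
        have h2 := hm x
        have h3 : ContinuousAt (fun s => φ (a s • x)) t :=
          ContinuousAt.comp (f := fun s => a s • x) (g := φ) hφ.continuousAt
            (ha.smul continuousAt_const)
        exact (h2.smul h3).sub continuousAt_const
      have h4 : Tendsto (fun s => ‖m s x • φ (a s • x) - m t x • φ (a t • x)‖ₑ ^ (2 : ℝ)) (𝓝 t)
          (𝓝 (‖m t x • φ (a t • x) - m t x • φ (a t • x)‖ₑ ^ (2 : ℝ))) :=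
        ((ENNReal.continuous_rpow_const.comp continuous_enorm).continuousAt).tendsto.comp h1
      simpa using h4
  simp only [lintegral_zero] at key
  have := (ENNReal.continuous_rpow_const (y := (1 / 2 : ℝ))).continuousAt.tendsto.comp key
  rw [ENNReal.zero_rpow_of_pos (by norm_num)] at this
  refine this.congr fun s => ?_
  rw [eLpNorm_eq_lintegral_rpow_enorm_toReal (by norm_num) (by norm_num)]
  simp

theorem eLpNorm_modulation_le {F : Space N → E} {m : Space N → ℂ} {a C : ℝ} (ha : 0 < a)
    (hb : ∀ x, ‖m x‖ ≤ C) :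
    eLpNorm (fun x => m x • F (a • x)) 2 volume
      ≤ ENNReal.ofReal C * (ENNReal.ofReal (a ^ (-((N : ℝ) / 2))) * eLpNorm F 2 volume) := by
  rw [← eLpNorm_comp_smul F ha]
  refine eLpNorm_le_mul_eLpNorm_of_ae_le_mul (Eventually.of_forall fun x => ?_) 2
  rw [norm_smul]
  exact mul_le_mul_of_nonneg_right (hb x) (norm_nonneg _)

theorem tendsto_eLpNorm_modulation {F : Space N → E} (hF : MemLp F 2 volume)
    {m : ℝ → Space N → ℂ} {a : ℝ → ℝ} {t C : ℝ}
    (ha : ContinuousAt a t) (hat : 0 < a t) (hb : ∀ᶠ s in 𝓝 t, ∀ x, ‖m s x‖ ≤ C)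
    (hm : ∀ x, ContinuousAt (fun s => m s x) t) (hmc : ∀ s, Continuous (m s)) :
    Tendsto (fun s => eLpNorm (fun x => m s x • F (a s • x) - m t x • F (a t • x)) 2 volume)
      (𝓝 t) (𝓝 0) := by
  rw [ENNReal.tendsto_nhds_zero]
  intro ε hε
  -- `D` bounds the L² operator norm of `F ↦ m s • F (a s • ·)` for all `s` with `a s > a t / 2`;
  -- the exponent `-N/2` is nonpositive, so the smallest dilation factor is the worst.
  set D : ENNReal := ENNReal.ofReal C * ENNReal.ofReal ((a t / 2) ^ (-((N : ℝ) / 2)))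
  have hD : D ≠ ⊤ := ENNReal.mul_ne_top ENNReal.ofReal_ne_top ENNReal.ofReal_ne_top
  have hε3 : ε / 3 ≠ 0 := (ENNReal.div_pos hε.ne' (by norm_num)).ne'
  obtain ⟨δ, hδ0, hδ⟩ : ∃ δ : ENNReal, δ ≠ 0 ∧ D * δ ≤ ε / 3 := by
    by_cases h : D = 0
    · exact ⟨1, one_ne_zero, by simp [h]⟩
    · exact ⟨ε / 3 / D, (ENNReal.div_pos hε3 hD).ne', ENNReal.mul_div_le⟩
  obtain ⟨φ, hφc, hφe, hφ, hφm⟩ := hF.exists_hasCompactSupport_eLpNorm_sub_le (by norm_num) hδ0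
  have hmid := tendsto_eLpNorm_modulation_of_hasCompactSupport hφ hφc ha hat hb hm hmc
  rw [ENNReal.tendsto_nhds_zero] at hmid
  have hsm : ∀ s : ℝ, 0 < a s → ∀ G : Space N → E, MemLp G 2 volume →
      AEStronglyMeasurable (fun x => m s x • G (a s • x)) volume := fun s hs G hG =>
    (hmc s).aestronglyMeasurable.smul (memLp_comp_smul hG hs).1
  have small : ∀ s : ℝ, a t / 2 < a s → (∀ x, ‖m s x‖ ≤ C) →
      eLpNorm (fun x => m s x • (F - φ) (a s • x)) 2 volume ≤ ε / 3 := by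
    intro s has hs
    have has0 : 0 < a s := by linarith
    refine (eLpNorm_modulation_le has0 hs).trans ?_
    rw [← mul_assoc]
    refine le_trans ?_ hδ
    gcongr
    refine mul_le_mul_right (ENNReal.ofReal_le_ofReal ?_) _
    exact Real.rpow_le_rpow_of_nonpos (by positivity) has.le (by simp; positivity)
  filter_upwards [hmid (ε / 3) (pos_iff_ne_zero.2 hε3), hb,
    ha.eventually (lt_mem_nhds (half_lt_self hat))] with s h1 hs has
  have has0 : 0 < a s := by linarith
  have hFφ := hF.sub hφm
  -- Three-epsilon argument: replacing `F` by the continuous compactly supported `φ` costs `D δ ≤ ε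
  -- / 3` at each of the times `s` and `t`.
  have e : (fun x => m s x • F (a s • x) - m t x • F (a t • x))
      = ((fun x => m s x • (F - φ) (a s • x))
        + (fun x => m s x • φ (a s • x) - m t x • φ (a t • x)))
        - (fun x => m t x • (F - φ) (a t • x)) := by
    ext x
    simp only [Pi.sub_apply, Pi.add_apply, smul_sub]
    abel
  rw [e]
  calc _ ≤ eLpNorm (fun x => m s x • (F - φ) (a s • x)) 2 volume
        + eLpNorm (fun x => m s x • φ (a s • x) - m t x • φ (a t • x)) 2 volume
        + eLpNorm (fun x => m t x • (F - φ) (a t • x)) 2 volume := by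
        refine (eLpNorm_sub_le ((hsm s has0 _ hFφ).add ((hsm s has0 _ hφm).sub (hsm t hat _ hφm)))
          (hsm t hat _ hFφ) (by norm_num)).trans ?_
        gcongr
        exact eLpNorm_add_le (hsm s has0 _ hFφ) ((hsm s has0 _ hφm).sub (hsm t hat _ hφm))
          (by norm_num)
    _ ≤ ε / 3 + ε / 3 + ε / 3 :=
        add_le_add (add_le_add (small s has hs) h1) (small t (half_lt_self hat) hb.self_of_nhds)
    _ = ε := ENNReal.add_thirds ε

end Continuity

/-! ### The real-valued L² norm -/

section L2Norm

variable {E : Type*} [NormedAddCommGroup E]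

theorem l2Norm_nonneg (f : Space N → E) : 0 ≤ l2Norm f := ENNReal.toReal_nonneg

theorem l2Norm_add_le {f g : Space N → E} (hf : MemLp f 2 volume) (hg : MemLp g 2 volume) :
    l2Norm (f + g) ≤ l2Norm f + l2Norm g := by
  unfold l2Norm
  rw [← ENNReal.toReal_add hf.2.ne hg.2.ne]
  exact ENNReal.toReal_mono (ENNReal.add_ne_top.2 ⟨hf.2.ne, hg.2.ne⟩)
    (eLpNorm_add_le hf.1 hg.1 (by norm_num))

theorem l2Norm_const_smul [NormedSpace ℂ E] (c : ℂ) (f : Space N → E) :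
    l2Norm (c • f) = ‖c‖ * l2Norm f := by
  unfold l2Norm
  rw [eLpNorm_const_smul, ENNReal.toReal_mul]
  simp

theorem abs_l2Norm_add_sub_le {f g : Space N → E} (hf : MemLp f 2 volume)
    (hg : MemLp g 2 volume) : |l2Norm (f + g) - l2Norm f| ≤ l2Norm g := by
  have h1 := l2Norm_add_le hf hg
  have h2 := l2Norm_add_le (hf.add hg) hg.neg
  have h3 : l2Norm (-g) = l2Norm g := by unfold l2Norm; rw [eLpNorm_neg]
  rw [add_neg_cancel_right, h3] at h2
  rw [abs_le]; constructor <;> linarith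

end L2Norm

/-! ### H¹ regularity, mass and blow-up speed of the explicit profile -/

/-- The factor multiplying the rescaled ground state in `S`. -/
noncomputable def chirp (T lam0 gam0 t : ℝ) (x : Space N) : ℂ :=
  Complex.exp (Complex.I * (gam0 : ℂ))
    * Complex.exp (Complex.I * ((lam0 ^ 2 / (T - t) : ℝ) : ℂ))
    * Complex.exp (-(Complex.I * ((‖x‖ ^ 2 / (4 * (T - t)) : ℝ) : ℂ)))
    * (((lam0 / (T - t)) ^ ((N : ℝ) / 2) : ℝ) : ℂ)

/-- The vector field `x ↦ ψ(x) x`, with complex coordinates. -/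
noncomputable def firstMoment (ψ : Space N → ℝ) (x : Space N) : EuclideanSpace ℂ (Fin N) :=
  WithLp.toLp 2 fun i => ((x i : ℝ) : ℂ) * (ψ x : ℂ)

/-- The gradient of `S` at time `t`, in the rescaled variable and up to the factor `chirp`. -/
noncomputable def gradProfile (ψ : Space N → ℝ) (g : Space N → EuclideanSpace ℂ (Fin N))
    (T lam0 t : ℝ) : Space N → EuclideanSpace ℂ (Fin N) :=
  ((lam0 / (T - t) : ℝ) : ℂ) • g + (-(Complex.I / (2 * lam0))) • firstMoment ψ

theorem S_eq (ψ : Space N → ℝ) (T lam0 gam0 t : ℝ) :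
    S ψ T lam0 gam0 t = fun x => chirp T lam0 gam0 t x * (ψ ((lam0 / (T - t)) • x) : ℂ) := rfl

theorem norm_chirp {T lam0 t : ℝ} (gam0 : ℝ) (hlam : 0 < lam0) (ht : t < T) (x : Space N) :
    ‖chirp T lam0 gam0 t x‖ = (lam0 / (T - t)) ^ ((N : ℝ) / 2) := by
  have h1 : ∀ r : ℝ, ‖Complex.exp (Complex.I * (r : ℂ))‖ = 1 := fun r => by
    rw [mul_comm]; exact Complex.norm_exp_ofReal_mul_I r
  have h2 : ∀ r : ℝ, ‖Complex.exp (-(Complex.I * (r : ℂ)))‖ = 1 := fun r => by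
    have := h1 (-r)
    rwa [Complex.ofReal_neg, mul_neg] at this
  have h3 : 0 < lam0 / (T - t) := div_pos hlam (by linarith)
  unfold chirp
  rw [norm_mul, norm_mul, norm_mul, h1, h1, h2, Complex.norm_real,
    Real.norm_of_nonneg (by positivity)]
  ring

theorem contDiff_chirp (T lam0 gam0 t : ℝ) :
    ContDiff ℝ ∞ (chirp T lam0 gam0 t : Space N → ℂ) := by
  unfold chirp
  have h : ContDiff ℝ ∞ (fun x : Space N => ((‖x‖ ^ 2 / (4 * (T - t)) : ℝ) : ℂ)) :=
    Complex.ofRealCLM.contDiff.comp ((contDiff_norm_sq ℝ).div_const _)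
  fun_prop

theorem fderiv_chirp (T lam0 gam0 t : ℝ) (x : Space N) (i : Fin N) :
    fderiv ℝ (chirp T lam0 gam0 t : Space N → ℂ) x (EuclideanSpace.single i 1)
      = -(Complex.I * ((x i / (2 * (T - t)) : ℝ) : ℂ)) * chirp T lam0 gam0 t x := by
  have h : HasFDerivAt (fun x : Space N => ‖x‖ ^ 2 / (4 * (T - t)))
      ((4 * (T - t))⁻¹ • (2 • innerSL ℝ x)) x := by
    simp only [div_eq_inv_mul]
    exact (hasStrictFDerivAt_norm_sq x).hasFDerivAt.const_mul _
  have h2 := ((Complex.ofRealCLM.hasFDerivAt.comp x h).const_mul Complex.I).neg.cexp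
  have h3 := ((h2.const_mul (Complex.exp (Complex.I * (gam0 : ℂ))
    * Complex.exp (Complex.I * ((lam0 ^ 2 / (T - t) : ℝ) : ℂ)))).mul_const
    (((lam0 / (T - t)) ^ ((N : ℝ) / 2) : ℝ) : ℂ))
  have h4 : fderiv ℝ (chirp T lam0 gam0 t : Space N → ℂ) x = _ := HasFDerivAt.fderiv h3
  rw [h4]
  unfold chirp
  have e : ((T - t : ℝ) : ℂ) = (T : ℂ) - t := Complex.ofReal_sub T t
  simp [EuclideanSpace.inner_single_right]
  rw [← e]
  generalize T - t = τ
  ring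

variable {ψ : Space N → ℝ} {g : Space N → EuclideanSpace ℂ (Fin N)} {T lam0 gam0 : ℝ}

/-- Differentiating the phase produces `-i x / (2(T - t))`, which is `-i y / (2 λ₀)` in the variable
`y = λ₀ x / (T - t)`. The part of the gradient due to the phase is therefore independent of time in
rescaled variables; only the coefficient of `g` blows up. -/
theorem hasWeakGradient_S (hψ : MemLp (fun x => (ψ x : ℂ)) 2 volume) (hg : MemLp g 2 volume)
    (h : HasWeakGradient (fun x => (ψ x : ℂ)) g) (hlam : 0 < lam0) {t : ℝ} (ht : t < T) :
    HasWeakGradient (S ψ T lam0 gam0 t)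
      (fun x => chirp T lam0 gam0 t x • gradProfile ψ g T lam0 t ((lam0 / (T - t)) • x)) := by
  have hT : 0 < T - t := by linarith
  have ha : 0 < lam0 / (T - t) := div_pos hlam hT
  have h1 := h.comp_smul ha
  have h2 := h1.mul_smooth
    (locallyIntegrable_comp_smul (locallyIntegrable_of_memLp_two hψ) ha)
    ((locallyIntegrable_comp_smul (locallyIntegrable_of_memLp_two hg) ha).smul
      ((lam0 / (T - t) : ℝ) : ℂ)) (contDiff_chirp T lam0 gam0 t)
  rw [S_eq]
  convert h2 using 2 with x
  ext i
  rw [PiLp.add_apply]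
  simp only [PiLp.smul_apply, fderiv_chirp, gradProfile, firstMoment, Pi.add_apply, Pi.smul_apply,
    PiLp.add_apply, smul_eq_mul]
  have e1 : (lam0 : ℂ) ≠ 0 := by exact_mod_cast hlam.ne'
  have e2 : ((T - t : ℝ) : ℂ) ≠ 0 := by exact_mod_cast hT.ne'
  push_cast at e2 ⊢
  field_simp

/-- The modulus `a^{N/2}` of the chirp cancels the factor `a^{-N/2}` coming from the dilation. -/
theorem eLpNorm_chirp_smul {E : Type*} [NormedAddCommGroup E] [NormedSpace ℂ E]
    (F : Space N → E) (gam0 : ℝ) (hlam : 0 < lam0) {t : ℝ} (ht : t < T) :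
    eLpNorm (fun x => chirp T lam0 gam0 t x • F ((lam0 / (T - t)) • x)) 2 volume
      = eLpNorm F 2 volume := by
  have ha : 0 < lam0 / (T - t) := div_pos hlam (by linarith)
  have e : eLpNorm (fun x => chirp T lam0 gam0 t x • F ((lam0 / (T - t)) • x)) 2 volume
      = eLpNorm ((((lam0 / (T - t)) ^ ((N : ℝ) / 2) : ℝ) : ℂ) •
        fun x => F ((lam0 / (T - t)) • x)) 2 volume := by
    refine eLpNorm_congr_norm_ae (Eventually.of_forall fun x => ?_)
    simp only [Pi.smul_apply, norm_smul]
    rw [norm_chirp gam0 hlam ht, Complex.norm_real, Real.norm_of_nonneg (by positivity)]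
  rw [e, eLpNorm_const_smul, eLpNorm_comp_smul F ha, ← mul_assoc]
  rw [← ofReal_norm, Complex.norm_real, Real.norm_of_nonneg (by positivity),
    ← ENNReal.ofReal_mul (by positivity), ← Real.rpow_add ha]
  simp

theorem memLp_chirp_smul {E : Type*} [NormedAddCommGroup E] [NormedSpace ℂ E]
    {F : Space N → E} (hF : MemLp F 2 volume) (gam0 : ℝ) (hlam : 0 < lam0) {t : ℝ} (ht : t < T) :
    MemLp (fun x => chirp T lam0 gam0 t x • F ((lam0 / (T - t)) • x)) 2 volume := by
  have ha : 0 < lam0 / (T - t) := div_pos hlam (by linarith)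
  refine ⟨(contDiff_chirp T lam0 gam0 t).continuous.aestronglyMeasurable.smul
    (memLp_comp_smul hF ha).1, ?_⟩
  rw [eLpNorm_chirp_smul F gam0 hlam ht]
  exact hF.2

theorem l2Norm_S (ψ : Space N → ℝ) (gam0 : ℝ) (hlam : 0 < lam0) {t : ℝ} (ht : t < T) :
    l2Norm (S ψ T lam0 gam0 t) = l2Norm ψ := by
  have h := eLpNorm_chirp_smul (fun x => (ψ x : ℂ)) gam0 hlam ht
  unfold l2Norm
  rw [S_eq]
  simp only [smul_eq_mul] at h
  rw [h]
  congr 1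
  exact eLpNorm_congr_norm_ae (Eventually.of_forall fun x => by simp)

theorem continuousAt_chirp {t : ℝ} (gam0 : ℝ) (hlam : 0 < lam0) (ht : t < T) (x : Space N) :
    ContinuousAt (fun s => chirp T lam0 gam0 s x) t := by
  have hT : T - t ≠ 0 := by linarith
  have h4 : 4 * (T - t) ≠ 0 := mul_ne_zero (by norm_num) hT
  have ha : lam0 / (T - t) ≠ 0 := (div_pos hlam (by linarith)).ne'
  have hc : ContinuousAt (fun s => T - s) t := by fun_prop
  have c1 : ContinuousAt (fun s => ((lam0 ^ 2 / (T - s) : ℝ) : ℂ)) t :=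
    Complex.continuous_ofReal.continuousAt.comp (continuousAt_const.div hc hT)
  have c2 : ContinuousAt (fun s => ((‖x‖ ^ 2 / (4 * (T - s)) : ℝ) : ℂ)) t :=
    Complex.continuous_ofReal.continuousAt.comp
      (continuousAt_const.div (continuousAt_const.mul hc) h4)
  have c3 : ContinuousAt (fun s => (((lam0 / (T - s)) ^ ((N : ℝ) / 2) : ℝ) : ℂ)) t :=
    Complex.continuous_ofReal.continuousAt.comp
      ((continuousAt_const.div hc hT).rpow_const (Or.inl ha))
  unfold chirp
  fun_prop

theorem continuousAt_scale {t : ℝ} (lam0 : ℝ) (ht : t < T) :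
    ContinuousAt (fun s => lam0 / (T - s)) t := by
  have hc : ContinuousAt (fun s => T - s) t := by fun_prop
  exact continuousAt_const.div hc (by linarith)

theorem eventually_norm_chirp_le {t : ℝ} (gam0 : ℝ) (hlam : 0 < lam0) (ht : t < T) :
    ∀ᶠ s in 𝓝 t, ∀ x : Space N,
      ‖chirp T lam0 gam0 s x‖ ≤ (lam0 / (T - t)) ^ ((N : ℝ) / 2) + 1 := by
  have ha : lam0 / (T - t) ≠ 0 := (div_pos hlam (by linarith)).ne'
  have h := (continuousAt_scale lam0 ht).rpow_const (p := (N : ℝ) / 2) (Or.inl ha)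
  filter_upwards [h.eventually (gt_mem_nhds (lt_add_one _)), gt_mem_nhds ht] with s hs hsT x
  rw [norm_chirp gam0 hlam hsT]
  exact hs.le

theorem tendsto_l2Norm_chirp_smul {E : Type*} [NormedAddCommGroup E] [NormedSpace ℂ E]
    {F : Space N → E} (hF : MemLp F 2 volume) (gam0 : ℝ) (hlam : 0 < lam0) {t : ℝ} (ht : t < T) :
    Tendsto (fun s => l2Norm (fun x => chirp T lam0 gam0 s x • F ((lam0 / (T - s)) • x)
      - chirp T lam0 gam0 t x • F ((lam0 / (T - t)) • x))) (𝓝 t) (𝓝 0) := by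
  have := tendsto_eLpNorm_modulation hF (continuousAt_scale lam0 ht)
    (div_pos hlam (by linarith)) (eventually_norm_chirp_le gam0 hlam ht)
    (continuousAt_chirp gam0 hlam ht) (fun s => (contDiff_chirp T lam0 gam0 s).continuous)
  exact (ENNReal.tendsto_toReal ENNReal.zero_ne_top).comp this

theorem memLp_gradProfile (hg : MemLp g 2 volume) (hx : MemLp (firstMoment ψ) 2 volume)
    (T lam0 t : ℝ) : MemLp (gradProfile ψ g T lam0 t) 2 volume :=
  (hg.const_smul _).add (hx.const_smul _)

theorem memH1_S (hψ : MemLp (fun x => (ψ x : ℂ)) 2 volume) (hg : MemLp g 2 volume)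
    (h : HasWeakGradient (fun x => (ψ x : ℂ)) g) (hx : MemLp (firstMoment ψ) 2 volume)
    (hlam : 0 < lam0) {t : ℝ} (ht : t < T) : MemH1 (S ψ T lam0 gam0 t) :=
  ⟨memLp_chirp_smul hψ gam0 hlam ht, _,
    memLp_chirp_smul (memLp_gradProfile hg hx T lam0 t) gam0 hlam ht,
    hasWeakGradient_S hψ hg h hlam ht⟩

theorem tendsto_h1Norm_S (hψ : MemLp (fun x => (ψ x : ℂ)) 2 volume) (hg : MemLp g 2 volume)
    (h : HasWeakGradient (fun x => (ψ x : ℂ)) g) (hx : MemLp (firstMoment ψ) 2 volume)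
    (hlam : 0 < lam0) {t : ℝ} (ht : t < T) :
    Tendsto (fun s => h1Norm (S ψ T lam0 gam0 s - S ψ T lam0 gam0 t)) (𝓝 t) (𝓝 0) := by
  have k1 : Tendsto (fun s => l2Norm (S ψ T lam0 gam0 s - S ψ T lam0 gam0 t)) (𝓝 t) (𝓝 0) :=
    tendsto_l2Norm_chirp_smul hψ gam0 hlam ht
  set G : ℝ → Space N → EuclideanSpace ℂ (Fin N) := fun s x =>
    chirp T lam0 gam0 s x • gradProfile ψ g T lam0 s ((lam0 / (T - s)) • x)
  have hG : ∀ s < T, MemLp (G s) 2 volume := fun s hs =>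
    memLp_chirp_smul (memLp_gradProfile hg hx T lam0 s) gam0 hlam hs
  have hS : ∀ s < T, MemLp (S ψ T lam0 gam0 s) 2 volume := fun s hs =>
    memLp_chirp_smul hψ gam0 hlam hs
  have e : ∀ᶠ s in 𝓝 t, l2Norm (weakGrad (S ψ T lam0 gam0 s - S ψ T lam0 gam0 t))
      = l2Norm (G s - G t) := by
    filter_upwards [gt_mem_nhds ht] with s hs
    exact l2Norm_weakGrad ((hS s hs).sub (hS t ht)) ((hG s hs).sub (hG t ht))
      (HasWeakGradient.sub (locallyIntegrable_of_memLp_two (hS s hs))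
        (locallyIntegrable_of_memLp_two (hS t ht)) (locallyIntegrable_of_memLp_two (hG s hs))
        (locallyIntegrable_of_memLp_two (hG t ht)) (hasWeakGradient_S hψ hg h hlam hs)
        (hasWeakGradient_S hψ hg h hlam ht))
  have k2 : Tendsto (fun s => l2Norm (G s - G t)) (𝓝 t) (𝓝 0) := by
    -- The profile itself depends on time. It is frozen at time `t`, which leaves a modulated
    -- dilation of a fixed function plus an error equal to the change of `λ₀/(T - s)` times the
    -- isometric image of `g`.
    set A := gradProfile ψ g T lam0 t
    have hA : MemLp A 2 volume := memLp_gradProfile hg hx T lam0 t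
    have b1 := tendsto_l2Norm_chirp_smul hA gam0 hlam ht
    have b2 : Tendsto (fun s => ‖((lam0 / (T - s) - lam0 / (T - t) : ℝ) : ℂ)‖ * l2Norm g) (𝓝 t)
        (𝓝 0) := by
      have : ContinuousAt
          (fun s => ‖((lam0 / (T - s) - lam0 / (T - t) : ℝ) : ℂ)‖ * l2Norm g) t :=
        ((Complex.continuous_ofReal.norm.continuousAt.comp
          ((continuousAt_scale lam0 ht).sub continuousAt_const))).mul continuousAt_const
      have := this.tendsto
      simpa using this
    have b3 := b2.add b1
    rw [zero_add] at b3
    refine squeeze_zero' (Eventually.of_forall fun s => l2Norm_nonneg _) ?_ b3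
    filter_upwards [gt_mem_nhds ht] with s hs
    set c : ℂ := ((lam0 / (T - s) - lam0 / (T - t) : ℝ) : ℂ) with hc
    have e1 : G s - G t = (fun x => chirp T lam0 gam0 s x • (c • g) ((lam0 / (T - s)) • x))
        + (fun x => chirp T lam0 gam0 s x • A ((lam0 / (T - s)) • x)
          - chirp T lam0 gam0 t x • A ((lam0 / (T - t)) • x)) := by
      ext1 x
      simp only [G, A, gradProfile, Pi.sub_apply, Pi.add_apply, Pi.smul_apply, hc,
        Complex.ofReal_sub]
      module
    have e2 : l2Norm (fun x => chirp T lam0 gam0 s x • (c • g) ((lam0 / (T - s)) • x))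
        = ‖c‖ * l2Norm g := by
      rw [← l2Norm_const_smul]
      unfold l2Norm
      rw [eLpNorm_chirp_smul _ gam0 hlam hs]
    rw [e1, ← e2]
    exact l2Norm_add_le (memLp_chirp_smul (hg.const_smul c) gam0 hlam hs)
      ((memLp_chirp_smul hA gam0 hlam hs).sub (memLp_chirp_smul hA gam0 hlam ht))
  have k3 := (k2.congr' (e.mono fun s hs => hs.symm))
  have k4 := (Real.continuous_sqrt.tendsto _).comp ((k1.pow 2).add (k3.pow 2))
  simpa [h1Norm, Function.comp_def] using k4

theorem isEquivalent_l2Norm_weakGrad_S (hψ : MemLp (fun x => (ψ x : ℂ)) 2 volume)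
    (hg : MemLp g 2 volume)
    (h : HasWeakGradient (fun x => (ψ x : ℂ)) g) (hx : MemLp (firstMoment ψ) 2 volume)
    (hlam : 0 < lam0) (hpos : 0 < l2Norm g) :
    (fun t => l2Norm (weakGrad (S ψ T lam0 gam0 t)))
      ~[𝓝[<] T] (fun t => (lam0 * l2Norm g) / (T - t)) := by
  -- The norm of the time-independent part of the profile: it bounds the gap to `λ₀ ‖g‖ / (T - t)`
  -- uniformly in `t`, which is negligible because that quantity diverges.
  set K := l2Norm ((-(Complex.I / (2 * lam0))) • firstMoment ψ)
  have key : ∀ t < T, |l2Norm (weakGrad (S ψ T lam0 gam0 t)) - (lam0 * l2Norm g) / (T - t)| ≤ K := by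
    intro t ht
    have e1 : l2Norm (weakGrad (S ψ T lam0 gam0 t)) = l2Norm (gradProfile ψ g T lam0 t) := by
      have hS : MemLp (S ψ T lam0 gam0 t) 2 volume := memLp_chirp_smul hψ gam0 hlam ht
      rw [l2Norm_weakGrad hS (memLp_chirp_smul (memLp_gradProfile hg hx T lam0 t) gam0 hlam ht)
        (hasWeakGradient_S hψ hg h hlam ht)]
      unfold l2Norm
      rw [eLpNorm_chirp_smul _ gam0 hlam ht]
    have e2 : (lam0 * l2Norm g) / (T - t) = l2Norm (((lam0 / (T - t) : ℝ) : ℂ) • g) := by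
      rw [l2Norm_const_smul, Complex.norm_real,
        Real.norm_of_nonneg (div_pos hlam (by linarith)).le]
      ring
    rw [e1, e2]
    exact abs_l2Norm_add_sub_le (hg.const_smul _) (hx.const_smul _)
  have hC : 0 < lam0 * l2Norm g := mul_pos hlam hpos
  have h0 : Tendsto (fun t => K / (lam0 * l2Norm g) * (T - t)) (𝓝[<] T) (𝓝 0) := by
    have : ContinuousAt (fun t => K / (lam0 * l2Norm g) * (T - t)) T := by fun_prop
    have := this.tendsto.mono_left (nhdsWithin_le_nhds (s := Set.Iio T))
    simpa using this
  refine (isLittleO_iff_tendsto' ?_).2 ?_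
  · filter_upwards [self_mem_nhdsWithin] with t (ht : t < T) h0
    exact absurd h0 (div_pos hC (by linarith)).ne'
  · refine squeeze_zero_norm' ?_ h0
    filter_upwards [self_mem_nhdsWithin] with t (ht : t < T)
    have hT : 0 < T - t := by linarith
    rw [norm_div, Real.norm_of_nonneg (div_pos hC hT).le, div_div_eq_mul_div, div_le_iff₀ hC]
    have := mul_le_mul_of_nonneg_right (key t ht) hT.le
    have e : K / (lam0 * l2Norm g) * (T - t) * (lam0 * l2Norm g) = K * (T - t) := by
      field_simp
    rw [e]
    exact this

/-! ### The equation for S, transferred to the test function -/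

/-- The time-dependent scalar factor of `pullback`. -/
noncomputable def pullbackCoeff (N : ℕ) (lam0 gam0 τ : ℝ) : ℂ :=
  Complex.exp (Complex.I * (gam0 : ℂ)) * Complex.exp (Complex.I * ((lam0 ^ 2 / τ : ℝ) : ℂ))
    * (((τ / lam0) ^ ((N : ℝ) / 2) : ℝ) : ℂ)

/-- The quadratic phase in self-similar variables. -/
noncomputable def quadPhase (lam0 τ : ℝ) (y : Space N) : ℂ :=
  Complex.exp (-(Complex.I * ((τ * ‖y‖ ^ 2 / (4 * lam0 ^ 2) : ℝ) : ℂ)))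

/-- The function `Φ` such that `∫ S(t) η = ∫ ψ Φ`, where `τ = T - t`. -/
noncomputable def pullback (lam0 gam0 : ℝ) (η : Space N → ℂ) (τ : ℝ) (y : Space N) : ℂ :=
  pullbackCoeff N lam0 gam0 τ * (quadPhase lam0 τ y * η ((τ / lam0) • y))

/-- The derivative of `pullback` with respect to `τ`. -/
noncomputable def pullbackDeriv (lam0 gam0 : ℝ) (η : Space N → ℂ) (τ : ℝ) (y : Space N) : ℂ :=
  pullbackCoeff N lam0 gam0 τ * (quadPhase lam0 τ y *
    ((-(Complex.I * ((lam0 ^ 2 / τ ^ 2 : ℝ) : ℂ)) + (((N : ℝ) / (2 * τ) : ℝ) : ℂ)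
      - Complex.I * ((‖y‖ ^ 2 / (4 * lam0 ^ 2) : ℝ) : ℂ)) * η ((τ / lam0) • y)
      + fderiv ℝ η ((τ / lam0) • y) (lam0⁻¹ • y)))

theorem hasDerivAt_pullbackCoeff (gam0 : ℝ) {lam0 τ : ℝ} (hlam : 0 < lam0) (hτ : 0 < τ) :
    HasDerivAt (pullbackCoeff N lam0 gam0)
      (pullbackCoeff N lam0 gam0 τ *
        (-(Complex.I * ((lam0 ^ 2 / τ ^ 2 : ℝ) : ℂ)) + (((N : ℝ) / (2 * τ) : ℝ) : ℂ))) τ := by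
  have h1 : HasDerivAt (fun τ : ℝ => lam0 ^ 2 / τ) (-(lam0 ^ 2 / τ ^ 2)) τ := by
    have := (hasDerivAt_inv hτ.ne').const_mul (lam0 ^ 2)
    simpa [div_eq_mul_inv] using this
  have h2 := (h1.ofReal_comp.const_mul Complex.I).cexp
  have h3 : HasDerivAt (fun τ : ℝ => (τ / lam0) ^ ((N : ℝ) / 2))
      ((τ / lam0) ^ ((N : ℝ) / 2) * (N / (2 * τ))) τ := by
    have := ((hasDerivAt_id τ).div_const lam0).rpow_const (p := (N : ℝ) / 2)
      (Or.inl (div_pos hτ hlam).ne')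
    refine this.congr_deriv ?_
    simp only [id]
    rw [Real.rpow_sub_one (div_pos hτ hlam).ne']
    field_simp
  have h4 := (h2.const_mul (Complex.exp (Complex.I * (gam0 : ℂ)))).mul h3.ofReal_comp
  refine h4.congr_deriv ?_
  unfold pullbackCoeff
  push_cast
  ring

theorem hasDerivAt_pullback (gam0 : ℝ) {lam0 τ : ℝ} (hlam : 0 < lam0) (hτ : 0 < τ)
    {η : Space N → ℂ} (hη : IsTestFunction η) (y : Space N) :
    HasDerivAt (fun τ => pullback lam0 gam0 η τ y) (pullbackDeriv lam0 gam0 η τ y) τ := by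
  have h1 := hasDerivAt_pullbackCoeff (N := N) gam0 hlam hτ
  have h2 : HasDerivAt (fun τ => quadPhase lam0 τ y)
      (quadPhase lam0 τ y * -(Complex.I * ((‖y‖ ^ 2 / (4 * lam0 ^ 2) : ℝ) : ℂ))) τ := by
    have : HasDerivAt (fun τ : ℝ => τ * ‖y‖ ^ 2 / (4 * lam0 ^ 2)) (‖y‖ ^ 2 / (4 * lam0 ^ 2)) τ := by
      simpa using ((hasDerivAt_id τ).mul_const (‖y‖ ^ 2)).div_const (4 * lam0 ^ 2)
    exact (this.ofReal_comp.const_mul Complex.I).neg.cexp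
  have h3 : HasDerivAt (fun τ : ℝ => η ((τ / lam0) • y))
      (fderiv ℝ η ((τ / lam0) • y) (lam0⁻¹ • y)) τ := by
    have : HasDerivAt (fun τ : ℝ => (τ / lam0) • y) (lam0⁻¹ • y) τ := by
      simpa using ((hasDerivAt_id τ).div_const lam0).smul_const y
    exact ((hη.1.differentiable (by simp) _).hasFDerivAt).comp_hasDerivAt τ this
  refine (h1.fun_mul (h2.fun_mul h3)).congr_deriv ?_
  unfold pullbackDeriv
  ring

theorem contDiff_quadPhase (lam0 τ : ℝ) : ContDiff ℝ ∞ (quadPhase lam0 τ : Space N → ℂ) := by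
  unfold quadPhase
  have h : ContDiff ℝ ∞ (fun x : Space N => ((τ * ‖x‖ ^ 2 / (4 * lam0 ^ 2) : ℝ) : ℂ)) :=
    Complex.ofRealCLM.contDiff.comp ((contDiff_const.mul (contDiff_norm_sq ℝ)).div_const _)
  fun_prop

theorem isTestFunction_pullback (gam0 : ℝ) {lam0 τ : ℝ} (hlam : 0 < lam0) (hτ : 0 < τ)
    {η : Space N → ℂ} (hη : IsTestFunction η) : IsTestFunction (pullback lam0 gam0 η τ) :=
  ((hη.comp_smul (div_pos hτ hlam).ne').mul_left (contDiff_quadPhase lam0 τ)).mul_left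
    contDiff_const

theorem fderiv_quadPhase (lam0 τ : ℝ) (y : Space N) (i : Fin N) :
    fderiv ℝ (quadPhase lam0 τ : Space N → ℂ) y (EuclideanSpace.single i 1)
      = -(Complex.I * ((τ / (2 * lam0 ^ 2) : ℝ) : ℂ)) * (y i : ℂ) * quadPhase lam0 τ y := by
  have h : HasFDerivAt (fun x : Space N => τ * ‖x‖ ^ 2 / (4 * lam0 ^ 2))
      ((τ / (4 * lam0 ^ 2)) • (2 • innerSL ℝ y)) y := by
    simp only [mul_div_right_comm]
    exact (hasStrictFDerivAt_norm_sq y).hasFDerivAt.const_mul _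
  have h2 := ((Complex.ofRealCLM.hasFDerivAt.comp y h).const_mul Complex.I).neg.cexp
  have h4 : fderiv ℝ (quadPhase lam0 τ : Space N → ℂ) y = _ := HasFDerivAt.fderiv h2
  rw [h4]
  unfold quadPhase
  simp [EuclideanSpace.inner_single_right]
  ring

theorem fderiv_apply_eq_sum {η : Space N → ℂ} (z y : Space N) :
    fderiv ℝ η z y = ∑ i : Fin N, (y i : ℂ) * fderiv ℝ η z (EuclideanSpace.single i 1) := by
  have h : y = ∑ i : Fin N, y i • (EuclideanSpace.single i (1 : ℝ) : Space N) := by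
    simpa using ((EuclideanSpace.basisFun (Fin N) ℝ).sum_repr y).symm
  conv_lhs => rw [h]
  simp

theorem laplacian_pullback (gam0 : ℝ) {lam0 τ : ℝ} (hlam : 0 < lam0) (hτ : 0 < τ)
    {η : Space N → ℂ} (hη : IsTestFunction η) (y : Space N) :
    Laplacian.laplacian (pullback lam0 gam0 η τ) y =
      pullbackCoeff N lam0 gam0 τ * (quadPhase lam0 τ y *
        ((-((τ ^ 2 * ‖y‖ ^ 2 / (4 * lam0 ^ 4) : ℝ) : ℂ)
            - Complex.I * ((τ * N / (2 * lam0 ^ 2) : ℝ) : ℂ)) * η ((τ / lam0) • y)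
          - Complex.I * ((τ ^ 2 / lam0 ^ 3 : ℝ) : ℂ) * fderiv ℝ η ((τ / lam0) • y) y
          + ((τ / lam0 : ℝ) : ℂ) ^ 2 * Laplacian.laplacian η ((τ / lam0) • y))) := by
  set σ := τ / lam0 with hσ
  set c := pullbackCoeff N lam0 gam0 τ
  set k : ℂ := -(Complex.I * ((τ / (2 * lam0 ^ 2) : ℝ) : ℂ)) with hk
  have hq : ∀ x, DifferentiableAt ℝ (quadPhase lam0 τ : Space N → ℂ) x :=
    fun x => (contDiff_quadPhase lam0 τ).differentiable (by simp) x
  -- Stated for an arbitrary test function because the second derivative applies it both to `η` and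
  -- to its partial derivatives.
  have step : ∀ ζ : Space N → ℂ, IsTestFunction ζ → ∀ x : Space N, ∀ i : Fin N,
      fderiv ℝ (fun y => quadPhase lam0 τ y * ζ (σ • y)) x (EuclideanSpace.single i 1)
        = quadPhase lam0 τ x * (k * (x i : ℂ) * ζ (σ • x)
          + (σ : ℂ) * fderiv ℝ ζ (σ • x) (EuclideanSpace.single i 1)) := by
    intro ζ hζ x i
    have hd : DifferentiableAt ℝ (fun y => ζ (σ • y)) x :=
      (hζ.1.comp (contDiff_const_smul σ)).differentiable (by simp) x
    rw [fderiv_fun_mul (hq x) hd, fderiv_comp_smul]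
    simp only [add_apply, smul_apply, fderiv_quadPhase,
      smul_eq_mul, Complex.real_smul]
    ring
  have step2 : ∀ i : Fin N,
      fderiv ℝ (fun x => fderiv ℝ (fun y => quadPhase lam0 τ y * η (σ • y)) x
        (EuclideanSpace.single i 1)) y (EuclideanSpace.single i 1)
      = quadPhase lam0 τ y * ((k ^ 2 * ((y i ^ 2 : ℝ) : ℂ) + k) * η (σ • y)
        + 2 * k * (σ : ℂ) * ((y i : ℂ) * fderiv ℝ η (σ • y) (EuclideanSpace.single i 1))
        + (σ : ℂ) ^ 2 * fderiv ℝ (fun z => fderiv ℝ η z (EuclideanSpace.single i 1)) (σ • y)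
          (EuclideanSpace.single i 1)) := by
    intro i
    have hηi := hη.fderiv_apply (EuclideanSpace.single i (1 : ℝ))
    have hf : (fun x => fderiv ℝ (fun y => quadPhase lam0 τ y * η (σ • y)) x
        (EuclideanSpace.single i 1)) = (fun x => k * ((x i : ℂ) * (quadPhase lam0 τ x * η (σ • x)))
          + (σ : ℂ) * (quadPhase lam0 τ x *
            (fun z => fderiv ℝ η z (EuclideanSpace.single i 1)) (σ • x))) := by
      ext x
      rw [step η hη]
      ring
    have d1 : DifferentiableAt ℝ (fun x => quadPhase lam0 τ x * η (σ • x)) y :=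
      (hq y).mul ((hη.1.comp (contDiff_const_smul σ)).differentiable (by simp) y)
    have d2 : DifferentiableAt ℝ (fun x => quadPhase lam0 τ x *
            (fun z => fderiv ℝ η z (EuclideanSpace.single i 1)) (σ • x)) y :=
      (hq y).mul ((hηi.1.comp (contDiff_const_smul σ)).differentiable (by simp) y)
    have d3 : HasFDerivAt (fun x : Space N => ((x i : ℝ) : ℂ))
        (Complex.ofRealCLM.comp (EuclideanSpace.proj i : Space N →L[ℝ] ℝ)) y :=
      (Complex.ofRealCLM.comp (EuclideanSpace.proj i : Space N →L[ℝ] ℝ)).hasFDerivAt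
    rw [hf, fderiv_fun_add ((d3.differentiableAt.fun_mul d1).const_mul k) (d2.const_mul _),
      fderiv_const_mul (d3.differentiableAt.fun_mul d1), fderiv_const_mul d2,
      fderiv_fun_mul d3.differentiableAt d1, d3.fderiv]
    simp only [add_apply, smul_apply, smul_eq_mul]
    rw [step η hη, step _ hηi]
    simp
    ring
  have e0 : pullback lam0 gam0 η τ = c • fun y => quadPhase lam0 τ y * η (σ • y) := by
    ext y; simp [pullback, c, σ]
  have hT : IsTestFunction (fun y => quadPhase lam0 τ y * η (σ • y)) :=
    (hη.comp_smul (div_pos hτ hlam).ne').mul_left (contDiff_quadPhase lam0 τ)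
  have hT2 : ContDiff ℝ 2 (fun y => quadPhase lam0 τ y * η (σ • y)) := contDiff_infty.1 hT.1 2
  rw [e0, InnerProductSpace.laplacian_smul _ hT2.contDiffAt, smul_eq_mul, laplacian_eq_sum hT2,
    laplacian_eq_sum (contDiff_infty.1 hη.1 2), fderiv_apply_eq_sum]
  simp only [step2]
  rw [← Finset.mul_sum, Finset.sum_add_distrib, Finset.sum_add_distrib, ← Finset.sum_mul,
    Finset.sum_add_distrib, ← Finset.mul_sum, ← Finset.mul_sum, ← Finset.mul_sum,
    ← Complex.ofReal_sum, ← EuclideanSpace.real_norm_sq_eq, Finset.sum_const, Finset.card_univ,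
    Fintype.card_fin, nsmul_eq_mul]
  have hl : (lam0 : ℂ) ≠ 0 := by exact_mod_cast hlam.ne'
  have e1 : k ^ 2 * ((‖y‖ ^ 2 : ℝ) : ℂ) = -((τ ^ 2 * ‖y‖ ^ 2 / (4 * lam0 ^ 4) : ℝ) : ℂ) := by
    rw [hk, neg_sq, mul_pow, Complex.I_sq]
    push_cast
    field_simp
    ring
  have e2 : (N : ℂ) * k = - (Complex.I * ((τ * N / (2 * lam0 ^ 2) : ℝ) : ℂ)) := by
    rw [hk]; push_cast; ring
  have e3 : 2 * k * (σ : ℂ) = -(Complex.I * ((τ ^ 2 / lam0 ^ 3 : ℝ) : ℂ)) := by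
    rw [hk, hσ]; push_cast; field_simp
  rw [e1, e2, e3]
  ring

/-- Pseudoconformal invariance in dual form. Terms match one by one: the phase `λ₀²/τ` yields `-Φ`;
the power `τ^{N/2}` and the `τ`-derivative of the quadratic phase match, respectively, the constant
and `|y|²` terms of the Laplacian of that phase; the motion of the dilation matches the cross term;
and `Φ[Δη]` matches the second-order term in `η`. -/
theorem pullback_identity (gam0 : ℝ) {lam0 τ : ℝ} (hlam : 0 < lam0) (hτ : 0 < τ)
    {η : Space N → ℂ} (hη : IsTestFunction η) (y : Space N) :
    -(Complex.I * pullbackDeriv lam0 gam0 η τ y)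
        + pullback lam0 gam0 (Laplacian.laplacian η) τ y
      = ((lam0 / τ : ℝ) : ℂ) ^ 2 *
        (Laplacian.laplacian (pullback lam0 gam0 η τ) y - pullback lam0 gam0 η τ y) := by
  rw [laplacian_pullback gam0 hlam hτ hη]
  unfold pullbackDeriv pullback
  rw [map_smul]
  have hl : (lam0 : ℂ) ≠ 0 := by exact_mod_cast hlam.ne'
  have ht : (τ : ℂ) ≠ 0 := by exact_mod_cast hτ.ne'
  rw [Complex.real_smul]
  generalize η ((τ / lam0) • y) = A
  generalize fderiv ℝ η ((τ / lam0) • y) y = B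
  generalize Laplacian.laplacian η ((τ / lam0) • y) = D
  generalize pullbackCoeff N lam0 gam0 τ = c
  generalize quadPhase lam0 τ y = q
  have hI := Complex.I_sq
  push_cast
  field_simp
  linear_combination (8 * A * c * q * lam0 ^ 4 + 2 * c * q * A * ‖y‖ ^ 2 * τ ^ 2 ) * hI

/-- The Jacobian `a^{-N}` combines with the amplitude `a^{N/2}` into `(τ/λ₀)^{N/2}`. The function
`v` is left general so that the formula serves for both `ψ` and its nonlinearity. -/
theorem integral_chirp_mul (v η : Space N → ℂ) (gam0 : ℝ) (hlam : 0 < lam0) {t : ℝ} (ht : t < T) :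
    ∫ x, chirp T lam0 gam0 t x * v ((lam0 / (T - t)) • x) * η x
      = ∫ y, v y * pullback lam0 gam0 η (T - t) y := by
  set τ := T - t with hτ
  have hτ0 : 0 < τ := by linarith
  set a := lam0 / τ with ha
  have ha0 : 0 < a := div_pos hlam hτ0
  have hinv : a⁻¹ = τ / lam0 := by rw [ha, inv_div]
  have s1 := Measure.integral_comp_smul (volume : Measure (Space N))
    (fun y => chirp T lam0 gam0 t (a⁻¹ • y) * v y * η (a⁻¹ • y)) a
  simp only [inv_smul_smul₀ ha0.ne'] at s1
  rw [s1, ← integral_smul]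
  congr 1
  ext y
  rw [finrank_euclideanSpace, Fintype.card_fin, abs_of_pos (by positivity), Complex.real_smul, hinv]
  unfold pullback pullbackCoeff quadPhase chirp
  rw [← hτ, ← ha]
  have e1 : ‖(τ / lam0) • y‖ ^ 2 / (4 * τ) = τ * ‖y‖ ^ 2 / (4 * lam0 ^ 2) := by
    rw [norm_smul, mul_pow, Real.norm_of_nonneg (by positivity)]
    field_simp
  have e2 : (a ^ N)⁻¹ * a ^ ((N : ℝ) / 2) = (τ / lam0) ^ ((N : ℝ) / 2) := by
    rw [← hinv, Real.inv_rpow ha0.le, ← Real.rpow_neg ha0.le, ← Real.rpow_natCast,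
      ← Real.rpow_neg ha0.le, ← Real.rpow_add ha0]
    congr 1
    ring
  rw [e1, ← e2, Complex.ofReal_mul]
  ring

/-- Only the smooth factor depends on `τ`, so local integrability of `u` is enough to differentiate
under the integral. -/
theorem hasDerivAt_integral_pullback (gam0 : ℝ) (hlam : 0 < lam0) {τ : ℝ} (hτ : 0 < τ)
    {η : Space N → ℂ} (hη : IsTestFunction η) {u : Space N → ℂ}
    (hu : LocallyIntegrable u volume) :
    Integrable (fun y => u y * pullbackDeriv lam0 gam0 η τ y) volume ∧
    HasDerivAt (fun τ => ∫ y, u y * pullback lam0 gam0 η τ y)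
      (∫ y, u y * pullbackDeriv lam0 gam0 η τ y) τ := by
  obtain ⟨R, hR⟩ := hη.2.isCompact.isBounded.subset_closedBall (0 : Space N)
  -- One ball for all `σ > τ / 2`: if `(σ/λ₀) y` lies in the support of `η`, then `‖y‖ ≤ λ₀ R / σ ≤
  -- 2 λ₀ |R| / τ`.
  set B : Set (Space N) := Metric.closedBall 0 (2 * lam0 * |R| / τ)
  have hBc : IsCompact B := isCompact_closedBall _ _
  have hcont : ContinuousOn (fun p : ℝ × Space N => pullbackDeriv lam0 gam0 η p.1 p.2)
      (Set.Icc (τ / 2) (2 * τ) ×ˢ B) := by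
    have h1 : ContinuousOn (fun p : ℝ × Space N => p.1) (Set.Icc (τ / 2) (2 * τ) ×ˢ B) := by
      fun_prop
    have hne : ∀ p ∈ Set.Icc (τ / 2) (2 * τ) ×ˢ B, (p : ℝ × Space N).1 ≠ 0 := by
      intro p hp
      have := hp.1.1
      linarith
    have hne2 : ∀ p ∈ Set.Icc (τ / 2) (2 * τ) ×ˢ B, (p : ℝ × Space N).1 ^ 2 ≠ 0 :=
      fun p hp => pow_ne_zero _ (hne p hp)
    have hne3 : ∀ p ∈ Set.Icc (τ / 2) (2 * τ) ×ˢ B, 2 * (p : ℝ × Space N).1 ≠ 0 :=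
      fun p hp => mul_ne_zero two_ne_zero (hne p hp)
    have c1 : ContinuousOn (fun p : ℝ × Space N => pullbackCoeff N lam0 gam0 p.1)
        (Set.Icc (τ / 2) (2 * τ) ×ˢ B) := by
      intro p hp
      have hp0 : 0 < p.1 := by have := hp.1.1; linarith
      exact ((hasDerivAt_pullbackCoeff (N := N) gam0 hlam hp0).continuousAt.comp
        (f := fun p : ℝ × Space N => p.1) continuous_fst.continuousAt).continuousWithinAt
    have c2 : Continuous (fun p : ℝ × Space N => quadPhase lam0 p.1 p.2) := by
      unfold quadPhase
      exact Complex.continuous_exp.comp (continuous_const.mul (Complex.continuous_ofReal.comp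
        (by fun_prop))).neg
    have c3 : Continuous (fun p : ℝ × Space N => η ((p.1 / lam0) • p.2)) :=
      hη.continuous.comp (by fun_prop)
    have c4 : Continuous (fun p : ℝ × Space N => fderiv ℝ η ((p.1 / lam0) • p.2) (lam0⁻¹ • p.2)) := by
      have h5 : Continuous (fderiv ℝ η) := hη.1.continuous_fderiv (by simp)
      exact (h5.comp (by fun_prop : Continuous (fun p : ℝ × Space N => (p.1 / lam0) • p.2))).clm_apply
        (by fun_prop)
    have c5 : ContinuousOn (fun p : ℝ × Space N => ((lam0 ^ 2 / p.1 ^ 2 : ℝ) : ℂ))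
        (Set.Icc (τ / 2) (2 * τ) ×ˢ B) :=
      Complex.continuous_ofReal.comp_continuousOn (continuousOn_const.div (h1.pow 2) hne2)
    have c6 : ContinuousOn (fun p : ℝ × Space N => (((N : ℝ) / (2 * p.1) : ℝ) : ℂ))
        (Set.Icc (τ / 2) (2 * τ) ×ˢ B) :=
      Complex.continuous_ofReal.comp_continuousOn
        (continuousOn_const.div (continuousOn_const.mul h1) hne3)
    have c7 : Continuous (fun p : ℝ × Space N => ((‖p.2‖ ^ 2 / (4 * lam0 ^ 2) : ℝ) : ℂ)) :=
      Complex.continuous_ofReal.comp (by fun_prop)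
    unfold pullbackDeriv
    exact c1.mul (c2.continuousOn.mul (((((continuousOn_const.mul c5).neg.add c6).sub
      (continuousOn_const.mul c7.continuousOn)).mul c3.continuousOn).add c4.continuousOn))
  obtain ⟨C, hC⟩ := (isCompact_Icc.prod hBc).exists_bound_of_continuousOn hcont
  have hzero : ∀ σ : ℝ, τ / 2 < σ → ∀ y ∉ B, pullbackDeriv lam0 gam0 η σ y = 0 := by
    intro σ hσ y hy
    have hmem : (σ / lam0) • y ∉ tsupport η := by
      intro h
      have h2 := hR h
      simp only [Metric.mem_closedBall, dist_zero_right, norm_smul, B, not_le] at h2 hy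
      rw [Real.norm_of_nonneg (div_pos (by linarith) hlam).le, div_mul_eq_mul_div,
        div_le_iff₀ hlam] at h2
      rw [div_lt_iff₀ hτ] at hy
      have h3 := le_abs_self R
      nlinarith [norm_nonneg y]
    have h1 : η ((σ / lam0) • y) = 0 := image_eq_zero_of_notMem_tsupport hmem
    have h2 : fderiv ℝ η ((σ / lam0) • y) = 0 :=
      image_eq_zero_of_notMem_tsupport (fun h => hmem (tsupport_fderiv_subset ℝ h))
    unfold pullbackDeriv
    rw [h1, h2]
    simp
  have hint : IntegrableOn u B volume := hu.integrableOn_isCompact hBc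
  refine hasDerivAt_integral_of_dominated_loc_of_deriv_le (μ := (volume : Measure (Space N)))
    (F := fun τ y => u y * pullback lam0 gam0 η τ y)
    (F' := fun τ y => u y * pullbackDeriv lam0 gam0 η τ y)
    (s := Set.Ioo (τ / 2) (2 * τ)) (bound := B.indicator (fun y => ‖u y‖ * C))
    (Ioo_mem_nhds (by linarith) (by linarith)) ?_ ?_ ?_ ?_ ?_ ?_
  · filter_upwards [lt_mem_nhds hτ] with σ hσ
    exact (integrable_mul_test hu (isTestFunction_pullback gam0 hlam hσ hη)).1
  · exact integrable_mul_test hu (isTestFunction_pullback gam0 hlam hτ hη)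
  · refine hu.aestronglyMeasurable.mul (Continuous.aestronglyMeasurable ?_)
    have h5 : Continuous (fderiv ℝ η) := hη.1.continuous_fderiv (by simp)
    have h6 := (contDiff_quadPhase (N := N) lam0 τ).continuous
    have h7 := hη.continuous
    unfold pullbackDeriv
    have h8 : Continuous (fun y : Space N => fderiv ℝ η ((τ / lam0) • y) (lam0⁻¹ • y)) :=
      (h5.comp (by fun_prop : Continuous (fun y : Space N => (τ / lam0) • y))).clm_apply
        (by fun_prop)
    fun_prop
  · refine Eventually.of_forall fun y σ hσ => ?_
    by_cases hy : y ∈ B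
    · rw [Set.indicator_of_mem hy, norm_mul]
      exact mul_le_mul_of_nonneg_left (hC (σ, y) ⟨⟨hσ.1.le, hσ.2.le⟩, hy⟩) (norm_nonneg _)
    · rw [Set.indicator_of_notMem hy]
      simp only [hzero σ hσ.1 y hy, mul_zero, norm_zero, le_refl]
  · exact (integrable_indicator_iff hBc.isClosed.measurableSet).2 (hint.norm.mul_const C)
  · refine Eventually.of_forall fun y σ hσ => ?_
    exact (hasDerivAt_pullback gam0 hlam (by linarith [hσ.1]) hη y).const_mul (u y)

/-- Criticality enters here: the amplitude contributes `a^{(N/2)(4-2b)/N} = a^{2-b}`, and the weight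
contributes `a^b` when rewritten at `a x`, for a total of `a²`. -/
theorem nonlin_S (hN : 1 ≤ N) (b : ℝ) (ψ : Space N → ℝ) (gam0 : ℝ) (hlam : 0 < lam0) {t : ℝ}
    (ht : t < T) :
    nonlin b (S ψ T lam0 gam0 t) = fun x => chirp T lam0 gam0 t x *
      (fun y => ((lam0 / (T - t) : ℝ) : ℂ) ^ 2 * nonlin b (fun y => (ψ y : ℂ)) y)
        ((lam0 / (T - t)) • x) := by
  have ha0 : 0 < lam0 / (T - t) := div_pos hlam (by linarith)
  have hN0 : (N : ℝ) ≠ 0 := by positivity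
  ext x
  rw [S_eq]
  unfold nonlin
  rw [norm_mul, norm_chirp gam0 hlam ht]
  set a := lam0 / (T - t)
  have e1 : ‖a • x‖ ^ (-b) = a ^ (-b) * ‖x‖ ^ (-b) := by
    rw [norm_smul, Real.norm_of_nonneg ha0.le, Real.mul_rpow ha0.le (norm_nonneg _)]
  have e2 : (a ^ ((N : ℝ) / 2) * ‖(ψ (a • x) : ℂ)‖) ^ ((4 - 2 * b) / (N : ℝ))
      = a ^ (2 - b) * ‖(ψ (a • x) : ℂ)‖ ^ ((4 - 2 * b) / (N : ℝ)) := by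
    rw [Real.mul_rpow (by positivity) (norm_nonneg _), ← Real.rpow_mul ha0.le]
    congr 2
    field_simp
    ring
  have e3 : a ^ (2 - b) = a ^ 2 * a ^ (-b) := by
    rw [← Real.rpow_natCast, ← Real.rpow_add ha0]
    congr 1
  beta_reduce
  rw [e1, e2, e3]
  push_cast
  ring

theorem IsGroundState.isSolutionOn_S {b : ℝ} {ψ : Space N → ℝ} (hN : 1 ≤ N)
    (hψ : IsGroundState b ψ) (hx : MemLp (firstMoment ψ) 2 volume) (gam0 : ℝ) (hlam : 0 < lam0) :
    IsSolutionOn b (Set.Iio T) (S ψ T lam0 gam0) := by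
  obtain ⟨h2, g, hg, hgrad⟩ := hψ.memH1
  have hloc : LocallyIntegrable (fun x => (ψ x : ℂ)) volume := locallyIntegrable_of_memLp_two h2
  refine ⟨fun t ht => memH1_S h2 hg hgrad hx hlam ht, fun t ht =>
    (tendsto_h1Norm_S h2 hg hgrad hx hlam ht).mono_left nhdsWithin_le_nhds, ?_, ?_⟩
  · intro t ht
    rw [nonlin_S hN b ψ gam0 hlam ht]
    have h1 : LocallyIntegrable
        (fun y => ((lam0 / (T - t) : ℝ) : ℂ) ^ 2 * nonlin b (fun y => (ψ y : ℂ)) y) volume :=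
      hψ.locallyIntegrable_nonlin.smul (((lam0 / (T - t) : ℝ) : ℂ) ^ 2)
    have h3 := locallyIntegrable_comp_smul h1 (div_pos hlam (sub_pos.2 ht))
    exact h3.continuous_mul (contDiff_chirp T lam0 gam0 t).continuous
  · intro η hη t ht
    have hτ : 0 < T - t := sub_pos.2 ht
    obtain ⟨hi, hd⟩ := hasDerivAt_integral_pullback gam0 hlam hτ hη hloc
    -- The sign comes from `d/dt = -d/dτ`.
    refine ⟨-∫ y, (ψ y : ℂ) * pullbackDeriv lam0 gam0 η (T - t) y, ?_, ?_⟩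
    · have h3 : HasDerivAt (fun s => T - s) (-1) t := by
        simpa using (hasDerivAt_id t).const_sub T
      have h4 := HasDerivAt.scomp t hd h3
      rw [neg_one_smul] at h4
      refine h4.hasDerivWithinAt.congr (fun s hs => ?_) ?_
      · exact integral_chirp_mul (fun y => (ψ y : ℂ)) η gam0 hlam hs
      · exact integral_chirp_mul (fun y => (ψ y : ℂ)) η gam0 hlam ht
    · have hΦ := isTestFunction_pullback gam0 hlam hτ hη
      have hΔ := isTestFunction_pullback gam0 hlam hτ hη.laplacian
      have e1 : ∫ x, S ψ T lam0 gam0 t x * Laplacian.laplacian η x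
          = ∫ y, (ψ y : ℂ) * pullback lam0 gam0 (Laplacian.laplacian η) (T - t) y :=
        integral_chirp_mul (fun y => (ψ y : ℂ)) _ gam0 hlam ht
      have e2 : ∫ x, nonlin b (S ψ T lam0 gam0 t) x * η x
          = ((lam0 / (T - t) : ℝ) : ℂ) ^ 2 * ∫ y, nonlin b (fun y => (ψ y : ℂ)) y *
            pullback lam0 gam0 η (T - t) y := by
        rw [nonlin_S hN b ψ gam0 hlam ht, ← integral_const_mul]
        refine (integral_chirp_mul (fun y => ((lam0 / (T - t) : ℝ) : ℂ) ^ 2 *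
          nonlin b (fun y => (ψ y : ℂ)) y) η gam0 hlam ht).trans ?_
        simp only [mul_assoc]
      have e3 : Complex.I * (-∫ y, (ψ y : ℂ) * pullbackDeriv lam0 gam0 η (T - t) y)
          + ∫ y, (ψ y : ℂ) * pullback lam0 gam0 (Laplacian.laplacian η) (T - t) y
          = ((lam0 / (T - t) : ℝ) : ℂ) ^ 2 *
            ((∫ y, (ψ y : ℂ) * Laplacian.laplacian (pullback lam0 gam0 η (T - t)) y)
              - ∫ y, (ψ y : ℂ) * pullback lam0 gam0 η (T - t) y) := by
        rw [← integral_sub (integrable_mul_test hloc hΦ.laplacian) (integrable_mul_test hloc hΦ),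
          ← integral_const_mul, mul_neg, ← integral_const_mul, ← integral_neg,
          ← integral_add (hi.const_mul Complex.I).fun_neg (integrable_mul_test hloc hΔ)]
        congr 1
        ext y
        have := pullback_identity gam0 hlam hτ hη y
        linear_combination (ψ y : ℂ) * this
      have e4 := hψ.equation _ hΦ
      rw [e1, e2, e3, ← mul_add, e4, mul_zero]

/-! ### Polar coordinates -/

section Polar

/-- The weight `r ^ (1 - N)`. -/
noncomputable def radialWeight (N : ℕ) (r : ℝ) : ℝ := (r ^ N)⁻¹ * r

theorem radialWeight_nonneg (N : ℕ) {r : ℝ} (hr : 0 ≤ r) : 0 ≤ radialWeight N r := by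
  unfold radialWeight; positivity

theorem radialWeight_le_one (hN : 1 ≤ N) {r : ℝ} (hr : 1 ≤ r) : radialWeight N r ≤ 1 := by
  unfold radialWeight
  rw [inv_mul_le_iff₀ (by positivity), mul_one]
  exact le_self_pow₀ hr (by omega)

theorem pow_mul_radialWeight (hN : 1 ≤ N) {r : ℝ} (hr : 0 < r) :
    r ^ (N - 1) * radialWeight N r = 1 := by
  obtain ⟨n, rfl⟩ : ∃ n, N = n + 1 := ⟨N - 1, by omega⟩
  unfold radialWeight
  rw [Nat.add_sub_cancel]
  field_simp
  rw [pow_succ]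

theorem measurable_radialWeight (N : ℕ) : Measurable (radialWeight N) := by
  unfold radialWeight; fun_prop

theorem nontrivial_space (hN : 1 ≤ N) : Nontrivial (Space N) := by
  have : Nonempty (Fin N) := ⟨⟨0, hN⟩⟩
  infer_instance

/-- The area of the unit sphere. -/
noncomputable def sphereArea (N : ℕ) : ℝ :=
  N * (volume : Measure (Space N)).real (Metric.ball 0 1)

theorem sphereArea_pos (hN : 1 ≤ N) : 0 < sphereArea N := by
  have : 0 < (volume : Measure (Space N)).real (Metric.ball 0 1) :=
    ENNReal.toReal_pos (Metric.measure_ball_pos volume _ one_pos).ne'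
      measure_ball_lt_top.ne
  have h : (0 : ℝ) < N := by exact_mod_cast hN
  exact mul_pos h this

theorem integral_radial (hN : 1 ≤ N) (G : ℝ → ℝ) :
    ∫ x : Space N, G ‖x‖ = sphereArea N * ∫ r in Set.Ioi (0 : ℝ), r ^ (N - 1) * G r := by
  have := nontrivial_space hN
  rw [integral_fun_norm_addHaar volume G, finrank_euclideanSpace, Fintype.card_fin]
  simp [sphereArea, mul_assoc]

theorem integrable_radial_iff (hN : 1 ≤ N) (G : ℝ → ℝ) :
    Integrable (fun x : Space N => G ‖x‖) volume ↔
      IntegrableOn (fun r : ℝ => r ^ (N - 1) * G r) (Set.Ioi 0) := by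
  have := nontrivial_space hN
  have := integrable_fun_norm_addHaar (E := Space N) volume (f := G)
  rwa [finrank_euclideanSpace, Fintype.card_fin] at this

theorem pow_mul_mul_radialWeight (hN : 1 ≤ N) (G : ℝ → ℝ) {r : ℝ} (hr : r ∈ Set.Ioi (0 : ℝ)) :
    r ^ (N - 1) * (G r * radialWeight N r) = G r := by
  rw [mul_left_comm, pow_mul_radialWeight hN hr, mul_one]

/-- The weight cancels the Jacobian `r^{N-1}`, so pairings with radial functions become unweighted
integrals on the half-line. -/
theorem integral_mul_radialWeight (hN : 1 ≤ N) (G : ℝ → ℝ) :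
    ∫ x : Space N, G ‖x‖ * radialWeight N ‖x‖ = sphereArea N * ∫ r in Set.Ioi (0 : ℝ), G r := by
  rw [integral_radial hN (fun r => G r * radialWeight N r)]
  congr 1
  exact setIntegral_congr_fun measurableSet_Ioi fun r hr => pow_mul_mul_radialWeight hN G hr

theorem integrable_mul_radialWeight_iff (hN : 1 ≤ N) (G : ℝ → ℝ) :
    Integrable (fun x : Space N => G ‖x‖ * radialWeight N ‖x‖) volume ↔
      IntegrableOn G (Set.Ioi 0) := by
  rw [integrable_radial_iff hN (fun r => G r * radialWeight N r)]
  exact integrableOn_congr_fun (fun r hr => pow_mul_mul_radialWeight hN G hr) measurableSet_Ioi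

/-- The indicator of the failure set, composed with the norm, has zero integral in polar
coordinates. Measurability of `P` is not required: integrability is transferred by an equivalence.
-/
theorem ae_norm_of_ae (hN : 1 ≤ N) {P : ℝ → Prop}
    (h : ∀ᵐ r ∂(volume.restrict (Set.Ioi (0 : ℝ))), P r) : ∀ᵐ x : Space N, P ‖x‖ := by
  classical
  set G : ℝ → ℝ := fun r => if P r then 0 else 1 with hG
  have h0 : (fun r : ℝ => r ^ (N - 1) * G r) =ᵐ[volume.restrict (Set.Ioi 0)] fun _ => 0 := by
    filter_upwards [h] with r hr
    simp [hG, hr]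
  have hint : Integrable (fun x : Space N => G ‖x‖) volume := by
    rw [integrable_radial_iff hN]
    exact (integrable_zero _ _ _).congr h0.symm
  have hzero : ∫ x : Space N, G ‖x‖ = 0 := by
    rw [integral_radial hN, integral_congr_ae h0]
    simp
  have hnn : 0 ≤ fun x : Space N => G ‖x‖ := fun x => by
    simp only [hG, Pi.zero_apply]; split_ifs <;> norm_num
  have := (integral_eq_zero_iff_of_nonneg hnn hint).1 hzero
  filter_upwards [this] with x hx
  by_contra hP
  simp [hG, hP] at hx

/-- Cauchy–Schwarz in additive form. The point is uniformity: the bound depends on `k` only through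
`M`, and not on the position `r₀`. -/
theorem annulus_pairing {F : Type*} [NormedAddCommGroup F] (hN : 1 ≤ N) {v : Space N → F}
    (hv : MemLp v 2 volume) {k : ℝ → ℝ} (hk : Measurable k) {r₀ M : ℝ} (hr₀ : 2 ≤ r₀)
    (hM : ∀ r, |k r| ≤ M) (hk0 : ∀ r, r ∉ Set.Icc (r₀ - 1) (r₀ + 1) → k r = 0) :
    Integrable (fun x => ‖v x‖ * (|k ‖x‖| * radialWeight N ‖x‖)) volume ∧
    ∫ x, ‖v x‖ * (|k ‖x‖| * radialWeight N ‖x‖)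
      ≤ (∫ x, ‖v x‖ ^ 2) + sphereArea N * (2 * M ^ 2) := by
  set I : ℝ → ℝ := (Set.Icc (r₀ - 1) (r₀ + 1)).indicator fun _ => M ^ 2 with hI
  have hsub : Set.Icc (r₀ - 1) (r₀ + 1) ⊆ Set.Ioi (0 : ℝ) := fun r hr => by
    have := hr.1
    simp only [Set.mem_Ioi]; linarith
  have hIint : IntegrableOn I (Set.Ioi 0) := by
    refine Integrable.integrableOn ?_
    rw [hI, integrable_indicator_iff measurableSet_Icc]
    exact integrableOn_const (by simp)
  have hIval : ∫ r in Set.Ioi (0 : ℝ), I r = 2 * M ^ 2 := by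
    rw [hI, setIntegral_indicator measurableSet_Icc, Set.inter_eq_self_of_subset_right hsub,
      setIntegral_const]
    simp only [measureReal_def, Real.volume_Icc, smul_eq_mul]
    rw [ENNReal.toReal_ofReal (by linarith)]
    ring
  have hI2 := (integrable_mul_radialWeight_iff (N := N) hN I).2 hIint
  have hv2 : Integrable (fun x => ‖v x‖ ^ 2) volume := hv.integrable_norm_pow (by norm_num)
  have hle : ∀ x : Space N, ‖v x‖ * (|k ‖x‖| * radialWeight N ‖x‖)
      ≤ ‖v x‖ ^ 2 + I ‖x‖ * radialWeight N ‖x‖ := by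
    intro x
    have hw := radialWeight_nonneg N (norm_nonneg x)
    by_cases hx : ‖x‖ ∈ Set.Icc (r₀ - 1) (r₀ + 1)
    · have hw1 : radialWeight N ‖x‖ ≤ 1 := radialWeight_le_one hN (by linarith [hx.1])
      rw [hI, Set.indicator_of_mem hx]
      have h1 := hM ‖x‖
      have h2 := abs_nonneg (k ‖x‖)
      set w := radialWeight N ‖x‖
      set K := |k ‖x‖|
      -- Since `‖x‖ ≥ r₀ - 1 ≥ 1` gives `w ≤ 1`, one factor of `w` can be dropped; the remaining one
      -- cancels the Jacobian, leaving `M²` times the length 2 of the interval.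
      have h3 : (K * w) ^ 2 ≤ M ^ 2 * w := by
        rw [mul_pow]
        have : K ^ 2 ≤ M ^ 2 := by gcongr
        have : w ^ 2 ≤ w := by nlinarith
        gcongr
      nlinarith [sq_nonneg (‖v x‖ - K * w), sq_nonneg (‖v x‖), sq_nonneg (K * w)]
    · rw [hk0 _ hx, hI, Set.indicator_of_notMem hx]
      simp
  have hnn : ∀ x : Space N, 0 ≤ ‖v x‖ * (|k ‖x‖| * radialWeight N ‖x‖) := fun x =>
    mul_nonneg (norm_nonneg _) (mul_nonneg (abs_nonneg _) (radialWeight_nonneg N (norm_nonneg x)))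
  have hint : Integrable (fun x => ‖v x‖ * (|k ‖x‖| * radialWeight N ‖x‖)) volume := by
    refine (hv2.add hI2).mono' ?_ (Eventually.of_forall fun x => ?_)
    · refine hv.1.norm.mul (Measurable.aestronglyMeasurable ?_)
      have := measurable_radialWeight N
      fun_prop
    · rw [Real.norm_of_nonneg (hnn x)]
      exact hle x
  refine ⟨hint, ?_⟩
  rw [← hIval, ← integral_mul_radialWeight hN, ← integral_add hv2 hI2]
  exact integral_mono hint (hv2.add hI2) hle

end Polar

/-! ### Divergence of radial vector fields -/

section RadialField

theorem hasFDerivAt_norm {x : Space N} (hx : x ≠ 0) :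
    HasFDerivAt (fun y : Space N => ‖y‖) (‖x‖⁻¹ • innerSL ℝ x) x := by
  have h := (hasStrictFDerivAt_norm_sq x).hasFDerivAt.sqrt (pow_ne_zero 2 (norm_ne_zero_iff.2 hx))
  simp only [Real.sqrt_sq (norm_nonneg _)] at h
  refine h.congr_fderiv ?_
  ext v
  simp
  ring

/-- The coordinates of the radial vector field `φ(|x|) |x|^{-N} x`. -/
noncomputable def radialField (φ : ℝ → ℝ) (i : Fin N) (x : Space N) : ℝ :=
  φ ‖x‖ * (‖x‖ ^ N)⁻¹ * x i

variable {φ : ℝ → ℝ}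

theorem radialField_eventuallyEq_zero (h0 : ∀ r ≤ 1, φ r = 0) (i : Fin N) {x : Space N}
    (hx : ‖x‖ < 1) : radialField φ i =ᶠ[𝓝 x] fun _ => 0 := by
  filter_upwards [continuous_norm.continuousAt.eventually (gt_mem_nhds hx)] with y hy
  simp [radialField, h0 _ hy.le]

theorem contDiff_radialField (hφ : ContDiff ℝ ∞ φ) (h0 : ∀ r ≤ 1, φ r = 0) (i : Fin N) :
    ContDiff ℝ ∞ (radialField φ i : Space N → ℝ) := by
  rw [contDiff_iff_contDiffAt]
  intro x
  by_cases hx : ‖x‖ < 1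
  · exact contDiffAt_const.congr_of_eventuallyEq (radialField_eventuallyEq_zero h0 i hx)
  · have hx0 : x ≠ 0 := by rintro rfl; simp at hx
    have hn : ContDiffAt ℝ ∞ (fun y : Space N => ‖y‖) x := contDiffAt_norm ℝ hx0
    have h1 : ContDiffAt ℝ ∞ (fun y : Space N => φ ‖y‖) x := hφ.contDiffAt.comp x hn
    have h2 : ContDiffAt ℝ ∞ (fun y : Space N => (‖y‖ ^ N)⁻¹) x :=
      (hn.pow N).inv (pow_ne_zero _ (norm_ne_zero_iff.2 hx0))
    have h3 : ContDiffAt ℝ ∞ (fun y : Space N => y i) x :=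
      (EuclideanSpace.proj i : Space N →L[ℝ] ℝ).contDiff.contDiffAt
    exact (h1.mul h2).mul h3

theorem hasCompactSupport_radialField (hφ : HasCompactSupport φ) (i : Fin N) :
    HasCompactSupport (radialField φ i : Space N → ℝ) := by
  obtain ⟨R, hR⟩ := hφ.isCompact.isBounded.subset_closedBall (0 : ℝ)
  refine HasCompactSupport.intro (isCompact_closedBall (0 : Space N) R) fun x hx => ?_
  have : φ ‖x‖ = 0 := by
    refine image_eq_zero_of_notMem_tsupport fun h => hx ?_
    have := hR h
    simpa using this
  simp [radialField, this]

/-- The field `|x|^{-N} x` is divergence free off the origin, so only the derivative of `φ`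
survives. The vanishing of `φ` up to radius 1 removes the singularity. -/
theorem sum_fderiv_radialField (hφ : ContDiff ℝ ∞ φ) (h0 : ∀ r ≤ 1, φ r = 0) (x : Space N) :
    ∑ i : Fin N, fderiv ℝ (radialField φ i) x (EuclideanSpace.single i 1)
      = deriv φ ‖x‖ * radialWeight N ‖x‖ := by
  by_cases hx : ‖x‖ < 1
  · have e1 : ∀ i : Fin N, fderiv ℝ (radialField φ i) x = 0 := fun i => by
      rw [(radialField_eventuallyEq_zero h0 i hx).fderiv_eq]; simp
    have e2 : deriv φ ‖x‖ = 0 := by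
      have : φ =ᶠ[𝓝 ‖x‖] fun _ => 0 := by
        filter_upwards [gt_mem_nhds hx] with r hr using h0 r hr.le
      rw [this.deriv_eq]; simp
    simp [e1, e2]
  · have hx0 : x ≠ 0 := by rintro rfl; simp at hx
    have hr : ‖x‖ ≠ 0 := norm_ne_zero_iff.2 hx0
    have hn := hasFDerivAt_norm hx0
    have h1 := ((hφ.differentiable (by simp) ‖x‖).hasDerivAt.comp_hasFDerivAt x hn)
    have h2 := ((hasDerivAt_pow N ‖x‖).inv (pow_ne_zero N hr)).comp_hasFDerivAt x hn
    have e : ∀ i : Fin N, fderiv ℝ (radialField φ i) x (EuclideanSpace.single i 1)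
        = φ ‖x‖ * (‖x‖ ^ N)⁻¹ + (deriv φ ‖x‖ * (‖x‖ ^ N)⁻¹
          - φ ‖x‖ * (N * ‖x‖ ^ (N - 1) / (‖x‖ ^ N) ^ 2)) * ‖x‖⁻¹ * x i ^ 2 := by
      intro i
      have h3 : HasFDerivAt (fun y : Space N => y i) (EuclideanSpace.proj i : Space N →L[ℝ] ℝ) x :=
        (EuclideanSpace.proj i : Space N →L[ℝ] ℝ).hasFDerivAt
      have h4 := (h1.mul h2).mul h3
      have h5 : fderiv ℝ (radialField φ i) x = _ := HasFDerivAt.fderiv h4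
      rw [h5]
      simp [EuclideanSpace.inner_single_right]
      ring
    simp only [e]
    rw [Finset.sum_add_distrib, ← Finset.mul_sum (f := fun i => x i ^ 2),
      ← EuclideanSpace.real_norm_sq_eq]
    simp only [Finset.sum_const, Finset.card_univ, Fintype.card_fin, nsmul_eq_mul]
    unfold radialWeight
    -- The split makes the truncated exponent `N - 1` explicit.
    rcases N with _ | n
    · simp
      field_simp
    · simp only [Nat.add_sub_cancel]
      field_simp
      ring

/-- Integration by parts against the radial field. Each coordinate of the field is at most `|φ|`
times the weight, and summing the coordinates crudely costs the factor `N`. -/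
theorem abs_integral_radial_le {ψ : Space N → ℝ} {g : Space N → EuclideanSpace ℂ (Fin N)}
    (hψ : LocallyIntegrable (fun x => (ψ x : ℂ)) volume)
    (h : HasWeakGradient (fun x => (ψ x : ℂ)) g) (hφ : ContDiff ℝ ∞ φ) (hc : HasCompactSupport φ)
    (h0 : ∀ r ≤ 1, φ r = 0)
    (hint : Integrable (fun x => ‖g x‖ * (|φ ‖x‖| * radialWeight N ‖x‖)) volume) :
    |∫ x, ψ x * (deriv φ ‖x‖ * radialWeight N ‖x‖)|
      ≤ N * ∫ x, ‖g x‖ * (|φ ‖x‖| * radialWeight N ‖x‖) := by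
  have ht : ∀ i : Fin N, IsTestFunction (fun x : Space N => (radialField φ i x : ℂ)) := fun i =>
    isTestFunction_ofReal (contDiff_radialField hφ h0 i) (hasCompactSupport_radialField hc i)
  have hd : ∀ (i : Fin N) (x : Space N), fderiv ℝ (fun x : Space N => (radialField φ i x : ℂ)) x
      (EuclideanSpace.single i 1)
      = ((fderiv ℝ (radialField φ i) x (EuclideanSpace.single i 1) : ℝ) : ℂ) := by
    intro i x
    have := Complex.ofRealCLM.hasFDerivAt.comp x
      ((contDiff_radialField hφ h0 i).differentiable (by simp) x).hasFDerivAt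
    have h5 : fderiv ℝ (fun x : Space N => (radialField φ i x : ℂ)) x = _ := HasFDerivAt.fderiv this
    rw [h5]
    simp
  have key : ((∫ x, ψ x * (deriv φ ‖x‖ * radialWeight N ‖x‖) : ℝ) : ℂ)
      = -∑ i : Fin N, ∫ x, g x i * (radialField φ i x : ℂ) := by
    rw [← integral_complex_ofReal, ← Finset.sum_neg_distrib,
      ← Finset.sum_congr rfl fun i _ => h _ (ht i) i,
      ← integral_finsetSum _ fun i _ => integrable_mul_test hψ ((ht i).fderiv_apply _)]
    congr 1
    ext x
    rw [← Finset.mul_sum]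
    simp only [hd]
    rw [← Complex.ofReal_sum, sum_fderiv_radialField hφ h0]
    push_cast
    ring
  rw [← Real.norm_eq_abs, ← Complex.norm_real, key, norm_neg]
  refine (norm_sum_le _ _).trans ?_
  have : ∀ i ∈ (Finset.univ : Finset (Fin N)), ‖∫ x, g x i * (radialField φ i x : ℂ)‖
      ≤ ∫ x, ‖g x‖ * (|φ ‖x‖| * radialWeight N ‖x‖) := by
    intro i _
    refine norm_integral_le_of_norm_le hint (Eventually.of_forall fun x => ?_)
    rw [norm_mul, Complex.norm_real]
    refine mul_le_mul (PiLp.norm_apply_le (g x) i) ?_ (norm_nonneg _) (norm_nonneg _)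
    unfold radialField radialWeight
    rw [norm_mul, norm_mul, mul_assoc, Real.norm_eq_abs, Real.norm_of_nonneg (by positivity)]
    gcongr
    exact PiLp.norm_apply_le x i
  refine (Finset.sum_le_sum this).trans ?_
  simp

end RadialField

/-! ### Boundedness of radial H¹ functions away from the origin -/

theorem memLp_of_memLp_ofReal {ψ : Space N → ℝ} (h : MemLp (fun x => (ψ x : ℂ)) 2 volume) :
    MemLp ψ 2 volume := by
  refine h.congr_norm ?_ (Eventually.of_forall fun x => by simp)
  have := Complex.continuous_re.comp_aestronglyMeasurable h.1
  simpa using this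

/-- A smooth function on the line, equal to `1` on `(-∞, 1/2]` and to `0` on `[1, ∞)`. -/
noncomputable def lineCutoff (s : ℝ) : ℝ := 1 - Real.smoothTransition (2 * s - 1)

theorem contDiff_lineCutoff : ContDiff ℝ ∞ lineCutoff := by
  unfold lineCutoff
  exact contDiff_const.sub (Real.smoothTransition.contDiff.comp (by fun_prop))

theorem lineCutoff_of_le {s : ℝ} (hs : s ≤ 1 / 2) : lineCutoff s = 1 := by
  unfold lineCutoff
  rw [Real.smoothTransition.zero_of_nonpos (by linarith), sub_zero]

theorem lineCutoff_of_ge {s : ℝ} (hs : 1 ≤ s) : lineCutoff s = 0 := by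
  unfold lineCutoff
  rw [Real.smoothTransition.one_of_one_le (by linarith), sub_self]

theorem abs_lineCutoff_le (s : ℝ) : |lineCutoff s| ≤ 1 := by
  unfold lineCutoff
  have h1 := Real.smoothTransition.nonneg (2 * s - 1)
  have h2 := Real.smoothTransition.le_one (2 * s - 1)
  rw [abs_le]; constructor <;> linarith

theorem deriv_lineCutoff_eq_zero {s : ℝ} (hs : s ∉ Set.Icc (1 / 2 : ℝ) 1) :
    deriv lineCutoff s = 0 := by
  rw [Set.mem_Icc, not_and_or, not_le, not_le] at hs
  rcases hs with hs | hs
  · have : lineCutoff =ᶠ[𝓝 s] fun _ => 1 := by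
      filter_upwards [gt_mem_nhds hs] with r hr using lineCutoff_of_le hr.le
    rw [this.deriv_eq]; simp
  · have : lineCutoff =ᶠ[𝓝 s] fun _ => 0 := by
      filter_upwards [lt_mem_nhds hs] with r hr using lineCutoff_of_ge hr.le
    rw [this.deriv_eq]; simp

theorem exists_bound_deriv_lineCutoff : ∃ M : ℝ, ∀ s, |deriv lineCutoff s| ≤ M := by
  obtain ⟨M, hM⟩ := (isCompact_Icc (a := (1 / 2 : ℝ)) (b := 1)).exists_bound_of_continuousOn
    (contDiff_lineCutoff.continuous_deriv (by simp)).continuousOn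
  refine ⟨max M 0, fun s => ?_⟩
  by_cases hs : s ∈ Set.Icc (1 / 2 : ℝ) 1
  · exact (hM s hs).trans (le_max_left _ _)
  · rw [deriv_lineCutoff_eq_zero hs]; simp

/-- Provides a smoothed Heaviside step at `r₀`, bounded by 1 however concentrated `h` is. -/
theorem exists_smooth_primitive {h : ℝ → ℝ} (hh : ContDiff ℝ ∞ h) (hnn : ∀ r, 0 ≤ h r)
    (hint : Integrable h volume) (h1 : ∫ r, h r = 1) {r₀ : ℝ}
    (h0 : ∀ r, h r ≠ 0 → |r - r₀| < 1 / 2) :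
    ∃ H : ℝ → ℝ, ContDiff ℝ ∞ H ∧ (∀ r, deriv H r = h r) ∧ (∀ r, |H r| ≤ 1) ∧
      ∀ r ≤ r₀ - 1 / 2, H r = 0 := by
  refine ⟨fun r => ∫ t in (r₀ - 1 / 2)..r, h t, ?_, ?_, ?_, ?_⟩
  · have hd : ∀ r, HasDerivAt (fun r => ∫ t in (r₀ - 1 / 2)..r, h t) (h r) r := fun r =>
      intervalIntegral.integral_hasDerivAt_right (hh.continuous.intervalIntegrable _ _)
        (hh.continuous.stronglyMeasurableAtFilter _ _) hh.continuous.continuousAt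
    rw [contDiff_infty_iff_deriv]
    refine ⟨fun r => (hd r).differentiableAt, ?_⟩
    have : deriv (fun r => ∫ t in (r₀ - 1 / 2)..r, h t) = h := funext fun r => (hd r).deriv
    rwa [this]
  · exact fun r => hh.continuous.deriv_integral h _ r
  · intro r
    rw [← h1, ← Real.norm_eq_abs]
    refine (intervalIntegral.norm_integral_le_integral_norm_uIoc).trans ?_
    simp only [fun t => Real.norm_of_nonneg (hnn t)]
    exact setIntegral_le_integral hint (Eventually.of_forall hnn)
  · intro r hr
    refine intervalIntegral.integral_zero_ae (Eventually.of_forall fun t ht => ?_)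
    by_contra hne
    have := h0 t hne
    rw [Set.uIoc_of_ge hr] at ht
    rw [abs_lt] at this
    linarith [ht.2]

theorem exists_profile (hN : 1 ≤ N) {ψ : Space N → ℝ} (hrad : ∀ x y, ‖x‖ = ‖y‖ → ψ x = ψ y) :
    ∃ f : ℝ → ℝ, ∀ x, ψ x = f ‖x‖ := by
  refine ⟨fun r => ψ (r • EuclideanSpace.single ⟨0, hN⟩ 1), fun x => hrad _ _ ?_⟩
  rw [norm_smul, norm_norm]
  simp

/-- A weak substitute for the one-dimensional Sobolev bound: averages of the profile against
unit-mass densities are controlled uniformly in the density. With `φ = H χ`, a smoothed step cut off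
to the right of `r₀`, one has `φ' = h + k` and `k = H χ'`. The pairing with `φ'` is controlled by
the gradient, the one with `k` by `ψ` itself. -/
theorem exists_bound_profile_pairing (hN : 1 ≤ N) {ψ : Space N → ℝ} {f : ℝ → ℝ}
    (hf : ∀ x, ψ x = f ‖x‖)
    (hH1 : MemH1 (fun x => (ψ x : ℂ))) :
    ∃ C : ℝ, ∀ r₀ : ℝ, 2 ≤ r₀ → ∀ h : ℝ → ℝ, ContDiff ℝ ∞ h → (∀ r, 0 ≤ h r) →
      Integrable h volume → ∫ r, h r = 1 → (∀ r, h r ≠ 0 → |r - r₀| < 1 / 2) →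
      ∫ r in Set.Ioi (0 : ℝ), h r * f r ≤ C := by
  obtain ⟨h2, g, hg, hgrad⟩ := hH1
  have hψ2 : MemLp ψ 2 volume := memLp_of_memLp_ofReal h2
  obtain ⟨M, hM⟩ := exists_bound_deriv_lineCutoff
  set A := sphereArea N
  have hA : 0 < A := sphereArea_pos hN
  refine ⟨(N * ((∫ x, ‖g x‖ ^ 2) + A * (2 * 1 ^ 2)) + ((∫ x, ‖ψ x‖ ^ 2) + A * (2 * M ^ 2))) / A,
    fun r₀ hr₀ h hh hnn hint h1 h0 => ?_⟩
  obtain ⟨H, hH, hHd, hHb, hH0⟩ := exists_smooth_primitive hh hnn hint h1 h0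
  set φ : ℝ → ℝ := fun r => H r * lineCutoff (r - r₀) with hφdef
  set k : ℝ → ℝ := fun r => H r * deriv lineCutoff (r - r₀) with hkdef
  have hφ : ContDiff ℝ ∞ φ := hH.mul (contDiff_lineCutoff.comp (by fun_prop))
  have hφ0 : ∀ r, r ∉ Set.Icc (r₀ - 1) (r₀ + 1) → φ r = 0 := by
    intro r hr
    rw [Set.mem_Icc, not_and_or, not_le, not_le] at hr
    rcases hr with hr | hr
    · simp [hφdef, hH0 r (by linarith)]
    · simp [hφdef, lineCutoff_of_ge (show 1 ≤ r - r₀ by linarith)]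
  have hk0 : ∀ r, r ∉ Set.Icc (r₀ - 1) (r₀ + 1) → k r = 0 := by
    intro r hr
    rw [Set.mem_Icc, not_and_or, not_le, not_le] at hr
    rcases hr with hr | hr
    · simp [hkdef, hH0 r (by linarith)]
    · have : deriv lineCutoff (r - r₀) = 0 :=
        deriv_lineCutoff_eq_zero fun h => by linarith [h.2]
      simp [hkdef, this]
  have hφ1 : ∀ r ≤ 1, φ r = 0 := fun r hr => by simp [hφdef, hH0 r (by linarith)]
  have hφc : HasCompactSupport φ := HasCompactSupport.intro isCompact_Icc hφ0
  have hφb : ∀ r, |φ r| ≤ 1 := fun r => by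
    rw [hφdef, abs_mul]
    exact mul_le_one₀ (hHb r) (abs_nonneg _) (abs_lineCutoff_le _)
  have hkb : ∀ r, |k r| ≤ M := fun r => by
    rw [hkdef, abs_mul]
    calc _ ≤ 1 * |deriv lineCutoff (r - r₀)| := by gcongr; exact hHb r
      _ ≤ M := by rw [one_mul]; exact hM _
  have hkm : Continuous k :=
    hH.continuous.mul ((contDiff_lineCutoff.continuous_deriv (by simp)).comp (by fun_prop))
  have hφd : ∀ r, deriv φ r = h r + k r := by
    intro r
    have d1 := (hH.differentiable (by simp) r).hasDerivAt
    have d2 : HasDerivAt (fun r => lineCutoff (r - r₀)) (deriv lineCutoff (r - r₀)) r :=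
      HasDerivAt.comp_sub_const r r₀
        (contDiff_lineCutoff.differentiable (by simp) (r - r₀)).hasDerivAt
    have d3 : deriv φ r = _ := (d1.fun_mul d2).deriv
    rw [d3, hHd]
    congr 1
    by_cases hr : h r = 0
    · simp [hr]
    -- The cutoff equals 1 wherever `h` is nonzero, so `h χ = h`.
    · have := (abs_lt.1 (h0 r hr)).2
      rw [lineCutoff_of_le this.le, mul_one]
  obtain ⟨i1, b1⟩ := annulus_pairing hN hg hφ.continuous.measurable hr₀ hφb hφ0
  obtain ⟨i2, b2⟩ := annulus_pairing hN hψ2 hkm.measurable hr₀ hkb hk0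
  obtain ⟨Mh, hMh⟩ : ∃ Mh, ∀ r, |h r| ≤ Mh := by
    have hc : HasCompactSupport h := HasCompactSupport.intro
      (isCompact_Icc (a := r₀ - 1) (b := r₀ + 1)) fun r hr => by
        by_contra hne
        have := abs_lt.1 (h0 r hne)
        exact hr ⟨by linarith, by linarith⟩
    exact hc.exists_bound_of_continuous hh.continuous
  -- Only integrability is kept: the bound `Mh` depends on `h` and must not enter `C`.
  obtain ⟨i3, -⟩ := annulus_pairing hN hψ2 hh.continuous.measurable hr₀ hMh fun r hr => by
    by_contra hne
    have := abs_lt.1 (h0 r hne)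
    exact hr ⟨by linarith, by linarith⟩
  have hw : ∀ x : Space N, |radialWeight N ‖x‖| = radialWeight N ‖x‖ := fun x =>
    abs_of_nonneg (radialWeight_nonneg N (norm_nonneg x))
  have toInt : ∀ q : ℝ → ℝ, Measurable q →
      Integrable (fun x => ‖ψ x‖ * (|q ‖x‖| * radialWeight N ‖x‖)) volume →
      Integrable (fun x => ψ x * (q ‖x‖ * radialWeight N ‖x‖)) volume := by
    intro q hq hi
    refine hi.mono' ?_ (Eventually.of_forall fun x => ?_)
    · refine hψ2.1.mul (Measurable.aestronglyMeasurable ?_)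
      have := measurable_radialWeight N
      fun_prop
    · rw [norm_mul, norm_mul, Real.norm_eq_abs (q _), Real.norm_eq_abs (radialWeight _ _), hw]
  have j2 := toInt k hkm.measurable i2
  have j3 := toInt h hh.continuous.measurable i3
  have e1 : ∫ x, ψ x * (deriv φ ‖x‖ * radialWeight N ‖x‖)
      = (∫ x, ψ x * (h ‖x‖ * radialWeight N ‖x‖)) + ∫ x, ψ x * (k ‖x‖ * radialWeight N ‖x‖) := by
    rw [← integral_add j3 j2]
    congr 1
    ext x
    rw [hφd]
    ring
  have e2 : ∫ x, ψ x * (h ‖x‖ * radialWeight N ‖x‖) = A * ∫ r in Set.Ioi (0 : ℝ), h r * f r := by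
    rw [← integral_mul_radialWeight hN (fun r => h r * f r)]
    congr 1
    ext x
    rw [hf]
    ring
  have a1 := (abs_integral_radial_le (locallyIntegrable_of_memLp_two h2) hgrad hφ hφc hφ1 i1).trans
    (mul_le_mul_of_nonneg_left b1 (Nat.cast_nonneg N))
  have a2 : |∫ x, ψ x * (k ‖x‖ * radialWeight N ‖x‖)|
      ≤ ∫ x, ‖ψ x‖ * (|k ‖x‖| * radialWeight N ‖x‖) := by
    refine (abs_integral_le_integral_abs).trans (le_of_eq ?_)
    congr 1
    ext x
    rw [abs_mul, abs_mul, hw, Real.norm_eq_abs]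
  rw [le_div_iff₀ hA, mul_comm, ← e2]
  have a3 := (abs_le.1 a1).2
  have a4 := (abs_le.1 a2).1
  linarith

/-- Bump densities shrinking to `r₀` turn the uniform bound on averages into a bound at almost every
point, by Lebesgue differentiation. -/
theorem exists_ae_bound_profile (hN : 1 ≤ N) {ψ : Space N → ℝ} {f : ℝ → ℝ}
    (hf : ∀ x, ψ x = f ‖x‖) (hH1 : MemH1 (fun x => (ψ x : ℂ))) :
    ∃ C : ℝ, ∀ᵐ r : ℝ, 2 < r → f r ≤ C := by
  obtain ⟨C, hC⟩ := exists_bound_profile_pairing hN hf hH1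
  refine ⟨C, ?_⟩
  have hψ2 : LocallyIntegrable ψ volume :=
    locallyIntegrable_of_memLp_two (memLp_of_memLp_ofReal hH1.1)
  -- Local integrability of `ψ` controls `f` only against `r^{N-1}`, so `f` is truncated away from
  -- zero.
  set F : ℝ → ℝ := (Set.Ioi 1).indicator f with hF
  have hFint : ∀ R : ℝ, IntegrableOn f (Set.Ioc 1 R) volume := by
    intro R
    have i1 : Integrable (fun x : Space N =>
        (Set.Ioc 1 R).indicator f ‖x‖ * radialWeight N ‖x‖) volume := by
      have i2 : IntegrableOn ψ (Metric.closedBall 0 R) volume :=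
        hψ2.integrableOn_isCompact (isCompact_closedBall _ _)
      have i3 : IntegrableOn ψ ((fun x : Space N => ‖x‖) ⁻¹' (Set.Ioc 1 R)) volume :=
        i2.mono_set fun x hx => by simpa using hx.2
      have hm : MeasurableSet ((fun x : Space N => ‖x‖) ⁻¹' (Set.Ioc 1 R)) :=
        measurable_norm measurableSet_Ioc
      have i4 := (integrable_indicator_iff hm).2 i3
      refine i4.norm.mono' ?_ (Eventually.of_forall fun x => ?_)
      · have : (fun x : Space N => (Set.Ioc 1 R).indicator f ‖x‖ * radialWeight N ‖x‖)
            = fun x => ((fun x : Space N => ‖x‖) ⁻¹' (Set.Ioc 1 R)).indicator ψ x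
              * radialWeight N ‖x‖ := by
          ext x
          by_cases hx : ‖x‖ ∈ Set.Ioc 1 R <;> simp [Set.indicator, hx, hf]
        rw [this]
        refine i4.1.mul (Measurable.aestronglyMeasurable ?_)
        have := measurable_radialWeight N
        fun_prop
      · by_cases hx : ‖x‖ ∈ Set.Ioc 1 R
        · have hx' : x ∈ (fun x : Space N => ‖x‖) ⁻¹' (Set.Ioc 1 R) := hx
          rw [Set.indicator_of_mem hx, Set.indicator_of_mem hx', norm_mul, ← hf]
          refine mul_le_of_le_one_right (norm_nonneg _) ?_
          rw [Real.norm_of_nonneg (radialWeight_nonneg N (norm_nonneg x))]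
          exact radialWeight_le_one hN hx.1.le
        · rw [Set.indicator_of_notMem hx]
          simp
    have i5 := (integrable_mul_radialWeight_iff hN _).1 i1
    rw [IntegrableOn, integrable_indicator_iff measurableSet_Ioc, IntegrableOn,
      Measure.restrict_restrict measurableSet_Ioc, Set.inter_eq_self_of_subset_left] at i5
    · exact i5
    · intro r hr
      exact lt_trans one_pos hr.1
  have hFloc : LocallyIntegrable F volume := by
    intro r
    refine ⟨Set.Iic (r + 1), Iic_mem_nhds (by linarith), ?_⟩
    rw [hF, IntegrableOn, integrable_indicator_iff measurableSet_Ioi, IntegrableOn,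
      Measure.restrict_restrict measurableSet_Ioi, Set.Ioi_inter_Iic]
    exact hFint _
  -- The shift by 2 keeps every outer radius at most `1/2`, as the support condition demands.
  set B : ℕ → ContDiffBump (0 : ℝ) := fun n =>
    ⟨1 / (2 * (n + 2)), 1 / (n + 2), by positivity, by
      apply one_div_lt_one_div_of_lt <;> linarith [(Nat.cast_nonneg n : (0 : ℝ) ≤ n)]⟩ with hB
  have hBt : Tendsto (fun n => (B n).rOut) atTop (𝓝 0) := by
    have := (tendsto_const_div_atTop_nhds_zero_nat (1 : ℝ)).comp (tendsto_add_atTop_nat 2)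
    refine this.congr fun n => ?_
    simp [hB]
  have hBk : ∀ᶠ n in atTop, (B n).rOut ≤ 2 * (B n).rIn := by
    refine Eventually.of_forall fun n => le_of_eq ?_
    simp only [hB]
    field_simp
  have hBh : ∀ n, (B n).rOut ≤ 1 / 2 := fun n => by
    simp only [hB]
    apply one_div_le_one_div_of_le <;> linarith [(Nat.cast_nonneg n : (0 : ℝ) ≤ n)]
  filter_upwards [ContDiffBump.ae_convolution_tendsto_right_of_locallyIntegrable hBt hBk hFloc]
    with r₀ hlim hr₀
  have hFr : F r₀ = f r₀ := Set.indicator_of_mem (show r₀ ∈ Set.Ioi 1 by simp; linarith) f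
  rw [← hFr]
  refine le_of_tendsto hlim (Eventually.of_forall fun n => ?_)
  rw [convolution_eq_swap]
  set h : ℝ → ℝ := fun t => (B n).normed volume (r₀ - t) with hh
  have hsupp : ∀ r, h r ≠ 0 → |r - r₀| < 1 / 2 := by
    intro r hr
    have : r₀ - r ∈ Function.support ((B n).normed volume) := hr
    rw [ContDiffBump.support_normed_eq, Metric.mem_ball, dist_zero_right, Real.norm_eq_abs,
      abs_sub_comm] at this
    exact this.trans_le (hBh n)
  have key := hC r₀ hr₀.le h ((B n).contDiff_normed.comp (by fun_prop))
    (fun r => (B n).nonneg_normed _) ((B n).integrable_normed.comp_sub_left r₀)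
    ((integral_sub_left_eq_self (fun t => (B n).normed volume t) volume r₀).trans
      (B n).integral_normed) hsupp
  refine le_trans (le_of_eq ?_) key
  rw [← integral_indicator measurableSet_Ioi]
  congr 1
  ext t
  simp only [ContinuousLinearMap.lsmul_apply, smul_eq_mul]
  by_cases ht : h t = 0
  · have : (B n).normed volume (r₀ - t) = 0 := ht
    simp [Set.indicator, ht, this]
  · have := abs_lt.1 (hsupp t ht)
    have h1 : t ∈ Set.Ioi (1 : ℝ) := by simp only [Set.mem_Ioi]; linarith
    have h2 : t ∈ Set.Ioi (0 : ℝ) := by simp only [Set.mem_Ioi]; linarith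
    rw [hF, Set.indicator_of_mem h1, Set.indicator_of_mem h2]

theorem exists_ae_bound_of_radial (hN : 1 ≤ N) {ψ : Space N → ℝ}
    (hrad : ∀ x y, ‖x‖ = ‖y‖ → ψ x = ψ y) (hH1 : MemH1 (fun x => (ψ x : ℂ))) :
    ∃ C : ℝ, ∀ᵐ x : Space N, 2 < ‖x‖ → ψ x ≤ C := by
  obtain ⟨f, hf⟩ := exists_profile hN hrad
  obtain ⟨C, hC⟩ := exists_ae_bound_profile hN hf hH1
  refine ⟨C, ?_⟩
  filter_upwards [ae_norm_of_ae hN (ae_restrict_of_ae hC)] with x hx h2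
  rw [hf]
  exact hx h2

/-! ### Annuli and annular cutoffs -/

section Annuli

/-- The closed annulus of radii `ρ` and `2 ρ`. -/
def annulus (N : ℕ) (ρ : ℝ) : Set (Space N) := {x | ρ ≤ ‖x‖ ∧ ‖x‖ ≤ 2 * ρ}

theorem isClosed_annulus (ρ : ℝ) : IsClosed (annulus N ρ) :=
  (isClosed_le continuous_const continuous_norm).inter (isClosed_le continuous_norm continuous_const)

theorem annulus_subset_closedBall (ρ : ℝ) :
    annulus N ρ ⊆ Metric.closedBall 0 (2 * ρ) := fun x hx => by simpa using hx.2

theorem isCompact_annulus (ρ : ℝ) : IsCompact (annulus N ρ) :=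
  (isCompact_closedBall (0 : Space N) (2 * ρ)).of_isClosed_subset (isClosed_annulus ρ)
    (annulus_subset_closedBall ρ)

/-- A smooth radial cutoff, equal to `1` for `1 ≤ |x| ≤ 2` and supported in `1/2 ≤ |x| ≤ 4`. -/
noncomputable def annulusCutoff (x : Space N) : ℝ :=
  Real.smoothTransition (2 * ‖x‖ ^ 2 - 1) * Real.smoothTransition (5 - ‖x‖ ^ 2)

theorem annulusCutoff_nonneg (x : Space N) : 0 ≤ annulusCutoff x :=
  mul_nonneg (Real.smoothTransition.nonneg _) (Real.smoothTransition.nonneg _)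

theorem annulusCutoff_eq_one {x : Space N} (h1 : 1 ≤ ‖x‖) (h2 : ‖x‖ ≤ 2) :
    annulusCutoff x = 1 := by
  unfold annulusCutoff
  rw [Real.smoothTransition.one_of_one_le (by nlinarith),
    Real.smoothTransition.one_of_one_le (by nlinarith), mul_one]

theorem annulusCutoff_eq_zero {x : Space N} (h : ¬ (1 / 2 ≤ ‖x‖ ∧ ‖x‖ ≤ 4)) :
    annulusCutoff x = 0 := by
  unfold annulusCutoff
  rw [not_and_or, not_le, not_le] at h
  have := norm_nonneg x
  rcases h with h | h
  · rw [Real.smoothTransition.zero_of_nonpos (by nlinarith), zero_mul]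
  · rw [Real.smoothTransition.zero_of_nonpos (x := 5 - ‖x‖ ^ 2) (by nlinarith), mul_zero]

theorem isTestFunction_annulusCutoff :
    IsTestFunction (fun x : Space N => (annulusCutoff x : ℂ)) := by
  refine isTestFunction_ofReal ?_ ?_
  · unfold annulusCutoff
    have h : ContDiff ℝ ∞ (fun x : Space N => ‖x‖ ^ 2) := contDiff_norm_sq ℝ
    exact (Real.smoothTransition.contDiff.comp ((contDiff_const.mul h).sub contDiff_const)).mul
      (Real.smoothTransition.contDiff.comp (contDiff_const.sub h))
  · refine HasCompactSupport.intro (isCompact_closedBall (0 : Space N) 4) fun x hx => ?_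
    refine annulusCutoff_eq_zero fun h => hx ?_
    simpa using h.2

theorem laplacian_annulusCutoff_eq_zero {x : Space N} (h : ¬ (1 / 2 ≤ ‖x‖ ∧ ‖x‖ ≤ 4)) :
    Laplacian.laplacian (fun x : Space N => (annulusCutoff x : ℂ)) x = 0 := by
  have hopen : IsOpen {y : Space N | ¬ (1 / 2 ≤ ‖y‖ ∧ ‖y‖ ≤ 4)} := by
    have : IsClosed {y : Space N | 1 / 2 ≤ ‖y‖ ∧ ‖y‖ ≤ 4} :=
      (isClosed_le continuous_const continuous_norm).inter
        (isClosed_le continuous_norm continuous_const)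
    exact this.isOpen_compl
  have h1 : (fun x : Space N => (annulusCutoff x : ℂ)) =ᶠ[𝓝 x] fun _ => 0 := by
    filter_upwards [hopen.mem_nhds h] with y hy
    rw [annulusCutoff_eq_zero hy, Complex.ofReal_zero]
  rw [(InnerProductSpace.laplacian_congr_nhds h1).self_of_nhds]
  simp

theorem laplacian_comp_smul {η : Space N → ℂ} (hη : IsTestFunction η) (c : ℝ) (x : Space N) :
    Laplacian.laplacian (fun x => η (c • x)) x = (c : ℂ) ^ 2 * Laplacian.laplacian η (c • x) := by
  have h2 : ContDiff ℝ 2 (fun x => η (c • x)) :=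
    contDiff_infty.1 (hη.1.comp (contDiff_const_smul c)) 2
  rw [laplacian_eq_sum h2, laplacian_eq_sum (contDiff_infty.1 hη.1 2), Finset.mul_sum]
  refine Finset.sum_congr rfl fun i _ => ?_
  set e : Space N := EuclideanSpace.single i 1
  have h3 : (fun y => fderiv ℝ (fun x => η (c • x)) y e)
      = fun y => (c : ℂ) * (fun z => fderiv ℝ η z e) (c • y) := by
    ext y
    rw [fderiv_comp_smul]
    simp
  have hd : DifferentiableAt ℝ (fun y => (fun z => fderiv ℝ η z e) (c • y)) x :=
    ((hη.fderiv_apply e).1.comp (contDiff_const_smul c)).differentiable (by simp) x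
  rw [h3, fderiv_const_mul hd, fderiv_comp_smul (𝕜 := ℝ) (f := fun z => fderiv ℝ η z e)]
  simp
  ring

end Annuli

/-! ### Decay of the ground state and its second moment -/

section Decay

variable {b : ℝ} {ψ : Space N → ℝ}

theorem IsGroundState.memLp (hψ : IsGroundState b ψ) : MemLp ψ 2 volume :=
  memLp_of_memLp_ofReal hψ.memH1.1

theorem IsGroundState.locallyIntegrable (hψ : IsGroundState b ψ) : LocallyIntegrable ψ volume :=
  locallyIntegrable_of_memLp_two hψ.memLp

theorem nonlin_ofReal (hψ : IsGroundState b ψ) (x : Space N) :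
    nonlin b (fun x => (ψ x : ℂ)) x
      = ((‖x‖ ^ (-b) * ψ x ^ ((4 - 2 * b) / (N : ℝ)) * ψ x : ℝ) : ℂ) := by
  unfold nonlin
  rw [Complex.norm_real, Real.norm_of_nonneg (hψ.pos x).le]
  push_cast
  ring

/-- Boundedness of `ψ` suffices, since the weight `|x|^{-b}` supplies the decay and `b < 2` makes
the power of `ψ` nonnegative. -/
theorem IsGroundState.exists_potential_le (hN : 1 ≤ N) (hb0 : 0 < b) (hb2 : b < 2)
    (hψ : IsGroundState b ψ) :
    ∃ R C : ℝ, 1 ≤ R ∧ 0 ≤ C ∧ (∀ᵐ x : Space N, R ≤ ‖x‖ → ψ x ≤ C) ∧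
      ∀ᵐ x : Space N, R ≤ ‖x‖ → ‖x‖ ^ (-b) * ψ x ^ ((4 - 2 * b) / (N : ℝ)) ≤ 1 / 2 := by
  obtain ⟨C, hC⟩ := exists_ae_bound_of_radial hN hψ.radial hψ.memH1
  set p := (4 - 2 * b) / (N : ℝ)
  have hp : 0 ≤ p := div_nonneg (by linarith) (Nat.cast_nonneg N)
  have hlim := (tendsto_rpow_neg_atTop hb0).mul_const (|C| ^ p)
  rw [zero_mul] at hlim
  obtain ⟨R, hR⟩ := eventually_atTop.1 (hlim.eventually (gt_mem_nhds (by norm_num : (0 : ℝ) < 1 / 2)))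
  refine ⟨max R 3, |C|, le_trans (by norm_num) (le_max_right _ _), abs_nonneg _, ?_, ?_⟩
  · filter_upwards [hC] with x hx hxR
    have := (le_max_right R 3).trans hxR
    exact (hx (by linarith)).trans (le_abs_self C)
  · filter_upwards [hC] with x hx hxR
    have := (le_max_right R 3).trans hxR
    refine le_trans ?_ (hR ‖x‖ ((le_max_left R 3).trans hxR)).le
    gcongr
    · exact (hψ.pos x).le
    · exact (hx (by linarith)).trans (le_abs_self C)

/-- The equation is tested with a cutoff at scale `ρ`. On its support `1 - V ≥ 1/2`, so positivity
of `ψ` makes one side at least half the annular integral; on the other side the Laplacian of the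
cutoff is `O(ρ^{-2})` and lives on three dyadic annuli. -/
theorem IsGroundState.exists_annulus_recursion (hN : 1 ≤ N) (hb0 : 0 < b) (hb2 : b < 2)
    (hψ : IsGroundState b ψ) :
    ∃ R K : ℝ, 1 ≤ R ∧ 0 ≤ K ∧ ∀ ρ, R ≤ ρ → ∫ x in annulus N ρ, ψ x ≤ K * ρ ^ (-2 : ℝ) *
      ((∫ x in annulus N (ρ / 2), ψ x) + (∫ x in annulus N ρ, ψ x)
        + ∫ x in annulus N (2 * ρ), ψ x) := by
  obtain ⟨R, C, hR1, -, -, hV⟩ := hψ.exists_potential_le hN hb0 hb2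
  set θ : Space N → ℂ := fun x => (annulusCutoff x : ℂ) with hθdef
  have hθ : IsTestFunction θ := isTestFunction_annulusCutoff
  obtain ⟨K, hK⟩ := hθ.laplacian.2.exists_bound_of_continuous hθ.laplacian.continuous
  have hK0 : 0 ≤ K := (norm_nonneg _).trans (hK 0)
  -- The cutoff reaches inward to `ρ / 2`, which must be at least `R`; the second 2 absorbs the
  -- factor `1/2` from `1 - V`.
  refine ⟨2 * R, 2 * K, by linarith, by positivity, fun ρ hρ => ?_⟩
  have hρ0 : 0 < ρ := by linarith
  set η : Space N → ℂ := fun x => θ (ρ⁻¹ • x) with hηdef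
  have hη : IsTestFunction η := hθ.comp_smul (inv_ne_zero hρ0.ne')
  have hnorm : ∀ x : Space N, ‖ρ⁻¹ • x‖ = ‖x‖ / ρ := fun x => by
    rw [norm_smul, Real.norm_of_nonneg (by positivity)]; field_simp
  have hl := hψ.locallyIntegrable
  have hlc : LocallyIntegrable (fun x => (ψ x : ℂ)) volume :=
    locallyIntegrable_of_memLp_two hψ.memH1.1
  have hnl := hψ.locallyIntegrable_nonlin
  set V : Space N → ℝ := fun x => ‖x‖ ^ (-b) * ψ x ^ ((4 - 2 * b) / (N : ℝ)) with hVdef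
  set W : Set (Space N) := annulus N (ρ / 2) ∪ annulus N ρ ∪ annulus N (2 * ρ) with hW
  have memW : ∀ x : Space N, 1 / 2 ≤ ‖ρ⁻¹ • x‖ ∧ ‖ρ⁻¹ • x‖ ≤ 4 → x ∈ W := by
    intro x hx
    rw [hnorm, le_div_iff₀ hρ0, div_le_iff₀ hρ0] at hx
    simp only [hW, annulus, Set.mem_union, Set.mem_ofPred_eq]
    by_cases h1 : ‖x‖ ≤ ρ
    · left; left; constructor <;> linarith
    · by_cases h2 : ‖x‖ ≤ 2 * ρ
      · left; right; constructor <;> linarith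
      · right; constructor <;> linarith
  have i1 := integrable_mul_test hlc hη
  have i2 := integrable_mul_test hnl hη
  have i3 := integrable_mul_test hlc hη.laplacian
  have heq : ∫ x, ((ψ x : ℂ) * η x - nonlin b (fun x => (ψ x : ℂ)) x * η x)
      = ∫ x, (ψ x : ℂ) * Laplacian.laplacian η x := by
    rw [integral_sub i1 i2]
    linear_combination -hψ.equation η hη
  have hreal : ∀ x, (ψ x : ℂ) * η x - nonlin b (fun x => (ψ x : ℂ)) x * η x
      = ((ψ x * annulusCutoff (ρ⁻¹ • x) * (1 - V x) : ℝ) : ℂ) := by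
    intro x
    rw [nonlin_ofReal hψ]
    simp only [hηdef, hθdef, hVdef]
    push_cast
    ring
  have i4 : Integrable (fun x => ψ x * annulusCutoff (ρ⁻¹ • x) * (1 - V x)) volume := by
    have := (i1.sub i2).re
    refine this.congr (Eventually.of_forall fun x => ?_)
    simp only [Pi.sub_apply, hreal]
    simp
  simp only [hreal] at heq
  rw [integral_complex_ofReal] at heq
  have hAint : ∀ σ, IntegrableOn ψ (annulus N σ) volume := fun σ =>
    hl.integrableOn_isCompact (isCompact_annulus σ)
  have hWint : IntegrableOn ψ W volume := ((hAint _).union (hAint _)).union (hAint _)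
  have hWm : MeasurableSet W := (((isClosed_annulus _).union (isClosed_annulus _)).union
    (isClosed_annulus _)).measurableSet
  have lower : (1 / 2) * ∫ x in annulus N ρ, ψ x
      ≤ ∫ x, ψ x * annulusCutoff (ρ⁻¹ • x) * (1 - V x) := by
    rw [← integral_const_mul, ← integral_indicator (isClosed_annulus ρ).measurableSet]
    refine integral_mono_ae ?_ i4 ?_
    · exact (integrable_indicator_iff (isClosed_annulus ρ).measurableSet).2
        ((hAint ρ).const_mul _)
    · filter_upwards [hV] with x hx
      have hp := (hψ.pos x).le
      by_cases hmem : 1 / 2 ≤ ‖ρ⁻¹ • x‖ ∧ ‖ρ⁻¹ • x‖ ≤ 4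
      · have hxR : R ≤ ‖x‖ := by
          have := hmem.1
          rw [hnorm, le_div_iff₀ hρ0] at this
          linarith
        have hVx : V x ≤ 1 / 2 := hx hxR
        have hnn := annulusCutoff_nonneg (ρ⁻¹ • x)
        by_cases hA : x ∈ annulus N ρ
        · rw [Set.indicator_of_mem hA]
          have h1 : annulusCutoff (ρ⁻¹ • x) = 1 := by
            apply annulusCutoff_eq_one
            · rw [hnorm, le_div_iff₀ hρ0]; linarith [hA.1]
            · rw [hnorm, div_le_iff₀ hρ0]; linarith [hA.2]
          rw [h1]
          nlinarith
        · rw [Set.indicator_of_notMem hA]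
          exact mul_nonneg (mul_nonneg hp hnn) (by linarith)
      · rw [annulusCutoff_eq_zero hmem]
        have hA : x ∉ annulus N ρ := by
          intro hA
          apply hmem
          rw [hnorm, le_div_iff₀ hρ0, div_le_iff₀ hρ0]
          constructor <;> linarith [hA.1, hA.2]
        rw [Set.indicator_of_notMem hA]
        simp
  have upper : ‖∫ x, (ψ x : ℂ) * Laplacian.laplacian η x‖ ≤ K * ρ ^ (-2 : ℝ) * ∫ x in W, ψ x := by
    rw [← integral_const_mul, ← integral_indicator hWm]
    refine norm_integral_le_of_norm_le
      ((integrable_indicator_iff hWm).2 (hWint.const_mul _)) (Eventually.of_forall fun x => ?_)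
    have hlap : Laplacian.laplacian η x = _ := laplacian_comp_smul hθ ρ⁻¹ x
    have hp := (hψ.pos x).le
    rw [hlap]
    by_cases hmem : 1 / 2 ≤ ‖ρ⁻¹ • x‖ ∧ ‖ρ⁻¹ • x‖ ≤ 4
    · rw [Set.indicator_of_mem (memW x hmem), norm_mul, norm_mul, norm_pow, Complex.norm_real,
        Complex.norm_real, Real.norm_of_nonneg hp, Real.norm_of_nonneg (by positivity : 0 ≤ ρ⁻¹)]
      have e : ρ⁻¹ ^ 2 = ρ ^ (-2 : ℝ) := by
        rw [Real.rpow_neg hρ0.le, inv_pow]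
        norm_cast
      rw [e]
      have := hK (ρ⁻¹ • x)
      calc ψ x * (ρ ^ (-2 : ℝ) * ‖Laplacian.laplacian θ (ρ⁻¹ • x)‖)
          ≤ ψ x * (ρ ^ (-2 : ℝ) * K) := by gcongr
        _ = K * ρ ^ (-2 : ℝ) * ψ x := by ring
    · rw [laplacian_annulusCutoff_eq_zero hmem]
      simp only [mul_zero, norm_zero]
      exact Set.indicator_nonneg (fun y _ => mul_nonneg (by positivity) (hψ.pos y).le) x
  have hWle : ∫ x in W, ψ x ≤ (∫ x in annulus N (ρ / 2), ψ x) + (∫ x in annulus N ρ, ψ x)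
        + ∫ x in annulus N (2 * ρ), ψ x := by
    have u : ∀ {s t : Set (Space N)}, IntegrableOn ψ s volume → IntegrableOn ψ t volume →
        ∫ x in s ∪ t, ψ x ≤ (∫ x in s, ψ x) + ∫ x in t, ψ x := by
      intro s t hs ht
      rw [← integral_add_measure hs ht]
      exact integral_mono_measure (Measure.restrict_union_le s t)
        (Eventually.of_forall fun x => (hψ.pos x).le) (Integrable.add_measure hs ht)
    refine (u ((hAint _).union (hAint _)) (hAint _)).trans ?_
    gcongr
    exact u (hAint _) (hAint _)
  rw [← heq, Complex.norm_real] at upper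
  have h3 := (le_abs_self _).trans upper
  have h4 := mul_le_mul_of_nonneg_left hWle (by positivity : 0 ≤ K * ρ ^ (-2 : ℝ))
  linarith

theorem exists_rpow_decay {A : ℝ → ℝ} {R₀ R K C₀ s₀ : ℝ} (hR₀ : 1 ≤ R₀) (hR : 1 ≤ R)
    (hK : 0 ≤ K) (hC₀ : 0 ≤ C₀) (h0 : ∀ ρ, R₀ ≤ ρ → A ρ ≤ C₀ * ρ ^ s₀)
    (hrec : ∀ ρ, R ≤ ρ → A ρ ≤ K * ρ ^ (-2 : ℝ) * (A (ρ / 2) + A ρ + A (2 * ρ))) (n : ℕ) :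
    ∃ R' C : ℝ, 1 ≤ R' ∧ 0 ≤ C ∧ ∀ ρ, R' ≤ ρ → A ρ ≤ C * ρ ^ (s₀ - 2 * n) := by
  induction n with
  | zero => exact ⟨R₀, C₀, hR₀, hC₀, by simpa using h0⟩
  | succ n ih =>
    obtain ⟨R', C, hR', hC, h⟩ := ih
    set s := s₀ - 2 * n
    -- The induction hypothesis is used at `ρ / 2`, `ρ` and `2 ρ`, so the threshold doubles and the
    -- constant collects the three dilation factors.
    refine ⟨max R (2 * R'), K * C * ((1 / 2) ^ s + 1 + 2 ^ s), hR.trans (le_max_left _ _),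
      by positivity, fun ρ hρ => ?_⟩
    have h1 : R ≤ ρ := (le_max_left _ _).trans hρ
    have h2 : 2 * R' ≤ ρ := (le_max_right _ _).trans hρ
    have hρ0 : 0 < ρ := by linarith
    refine (hrec ρ h1).trans ?_
    have e1 : (ρ / 2) ^ s = (1 / 2) ^ s * ρ ^ s := by
      rw [← Real.mul_rpow (by norm_num) hρ0.le]; congr 1; ring
    have e2 : (2 * ρ) ^ s = 2 ^ s * ρ ^ s := Real.mul_rpow (by norm_num) hρ0.le
    have e3 : ρ ^ (s₀ - 2 * ((n + 1 : ℕ) : ℝ)) = ρ ^ (-2 : ℝ) * ρ ^ s := by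
      rw [← Real.rpow_add hρ0]; congr 1; simp only [s]; push_cast; ring
    have b1 := h (ρ / 2) (by linarith)
    have b2 := h ρ (by linarith)
    have b3 := h (2 * ρ) (by linarith)
    rw [e1] at b1
    rw [e2] at b3
    calc K * ρ ^ (-2 : ℝ) * (A (ρ / 2) + A ρ + A (2 * ρ))
        ≤ K * ρ ^ (-2 : ℝ) * (C * ((1 / 2) ^ s * ρ ^ s) + C * ρ ^ s + C * (2 ^ s * ρ ^ s)) := by
          gcongr
      _ = _ := by rw [e3]; ring

theorem IsGroundState.exists_annulus_decay (hN : 1 ≤ N) (hb0 : 0 < b) (hb2 : b < 2)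
    (hψ : IsGroundState b ψ) :
    ∃ R C : ℝ, 1 ≤ R ∧ 0 ≤ C ∧ ∀ ρ, R ≤ ρ → ∫ x in annulus N ρ, ψ x ≤ C * ρ ^ (-3 : ℝ) := by
  obtain ⟨R, K, hR, hK, hrec⟩ := hψ.exists_annulus_recursion hN hb0 hb2
  obtain ⟨R₀, C, hR₀, hC, hbd, -⟩ := hψ.exists_potential_le hN hb0 hb2
  have := nontrivial_space hN
  set v := 2 ^ N * (volume : Measure (Space N)).real (Metric.closedBall 0 1) with hv
  have h0 : ∀ ρ, R₀ ≤ ρ → ∫ x in annulus N ρ, ψ x ≤ C * v * ρ ^ (N : ℝ) := by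
    intro ρ hρ
    have hρ0 : 0 < ρ := by linarith
    have hm := (isClosed_annulus (N := N) ρ).measurableSet
    have hfin : (volume : Measure (Space N)) (annulus N ρ) ≠ ⊤ := (isCompact_annulus ρ).measure_lt_top.ne
    have hle : ∫ x in annulus N ρ, ψ x ≤ ∫ _x in annulus N ρ, C := by
      refine setIntegral_mono_on_ae (hψ.locallyIntegrable.integrableOn_isCompact (isCompact_annulus ρ))
        (integrableOn_const hfin) hm ?_
      filter_upwards [hbd] with x hx hxA
      exact hx (hρ.trans hxA.1)
    refine hle.trans ?_
    rw [setIntegral_const, smul_eq_mul, mul_comm, mul_assoc]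
    refine mul_le_mul_of_nonneg_left ?_ hC
    refine (measureReal_mono (annulus_subset_closedBall ρ)
      measure_closedBall_lt_top.ne).trans (le_of_eq ?_)
    rw [Measure.addHaar_real_closedBall' _ _ (by positivity), finrank_euclideanSpace,
      Fintype.card_fin, Real.rpow_natCast, hv, mul_pow]
    ring
  -- The volume bound starts the iteration at exponent `N`, and each round gains 2; this `n` brings
  -- it to at most `-3`.
  obtain ⟨n, hn⟩ := exists_nat_ge (((N : ℝ) + 3) / 2)
  obtain ⟨R', C', hR', hC', h⟩ := exists_rpow_decay hR₀ hR hK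
    (mul_nonneg hC (by positivity)) h0 hrec n
  refine ⟨R', C', hR', hC', fun ρ hρ => (h ρ hρ).trans ?_⟩
  refine mul_le_mul_of_nonneg_left (Real.rpow_le_rpow_of_exponent_le (hR'.trans hρ) ?_) hC'
  rw [div_le_iff₀ (by norm_num)] at hn
  linarith

theorem norm_firstMoment (ψ : Space N → ℝ) (x : Space N) : ‖firstMoment ψ x‖ = ‖x‖ * |ψ x| := by
  have : firstMoment ψ x
      = (ψ x : ℂ) • (WithLp.toLp 2 fun i => ((x i : ℝ) : ℂ) : EuclideanSpace ℂ (Fin N)) := by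
    ext i
    simp [firstMoment, mul_comm]
  rw [this, norm_smul, Complex.norm_real, Real.norm_eq_abs, mul_comm]
  congr 1
  rw [EuclideanSpace.norm_eq, EuclideanSpace.norm_eq]
  simp

theorem aestronglyMeasurable_firstMoment (hψ : AEStronglyMeasurable ψ volume) :
    AEStronglyMeasurable (firstMoment ψ) volume := by
  have h1 : Continuous fun x : Space N =>
      (WithLp.toLp 2 fun i => ((x i : ℝ) : ℂ) : EuclideanSpace ℂ (Fin N)) := by fun_prop
  have h2 : AEStronglyMeasurable (fun x => (ψ x : ℂ)) volume :=
    Complex.continuous_ofReal.comp_aestronglyMeasurable hψ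
  refine (h2.smul h1.aestronglyMeasurable).congr (Eventually.of_forall fun x => ?_)
  ext i
  simp [firstMoment, mul_comm]

/-- On an annulus of scale `ρ`, `|x|² ψ² ≤ 4 ρ² C ψ`: one factor of `ψ` is bounded pointwise and the
other integrates to `O(ρ^{-3})`. The resulting `O(ρ^{-1})` is summable over dyadic scales. -/
theorem IsGroundState.memLp_firstMoment (hN : 1 ≤ N) (hb0 : 0 < b) (hb2 : b < 2)
    (hψ : IsGroundState b ψ) : MemLp (firstMoment ψ) 2 volume := by
  rw [memLp_two_iff_integrable_sq_norm (aestronglyMeasurable_firstMoment hψ.memLp.1)]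
  obtain ⟨R₁, C₁, hR₁, hC₁, h1⟩ := hψ.exists_annulus_decay hN hb0 hb2
  obtain ⟨R₂, C₂, hR₂, hC₂, h2, -⟩ := hψ.exists_potential_le hN hb0 hb2
  set R := max R₁ R₂
  have hR : 1 ≤ R := hR₁.trans (le_max_left _ _)
  set F : Space N → ℝ := fun x => ‖firstMoment ψ x‖ ^ 2 with hF
  have hFx : ∀ x, F x = ‖x‖ ^ 2 * ψ x ^ 2 := fun x => by
    simp only [hF, norm_firstMoment, mul_pow, sq_abs]
  have hFm : AEStronglyMeasurable F volume :=
    (aestronglyMeasurable_firstMoment hψ.memLp.1).norm.pow 2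
  have hsq : Integrable (fun x => ψ x ^ 2) volume := hψ.memLp.integrable_sq
  have hball : IntegrableOn F (Metric.closedBall 0 R) volume := by
    refine (hsq.integrableOn.const_mul (R ^ 2)).mono' hFm.restrict ?_
    refine (ae_restrict_iff' Metric.isClosed_closedBall.measurableSet).2
      (Eventually.of_forall fun x hx => ?_)
    have hx' : ‖x‖ ≤ R := by simpa using hx
    rw [hFx, Real.norm_of_nonneg (by positivity)]
    gcongr
  have hann : ∀ ρ, R ≤ ρ → IntegrableOn F (annulus N ρ) volume ∧
      ∫ x in annulus N ρ, ‖F x‖ ≤ 4 * C₂ * C₁ * ρ⁻¹ := by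
    intro ρ hρ
    have hρ0 : 0 < ρ := by linarith
    have hm := (isClosed_annulus (N := N) ρ).measurableSet
    have hψi : IntegrableOn ψ (annulus N ρ) volume :=
      hψ.locallyIntegrable.integrableOn_isCompact (isCompact_annulus ρ)
    have hle : ∀ᵐ x ∂(volume.restrict (annulus N ρ)), ‖F x‖ ≤ 4 * ρ ^ 2 * C₂ * ψ x := by
      refine (ae_restrict_iff' hm).2 ?_
      filter_upwards [h2] with x hx hxA
      have hp := (hψ.pos x).le
      have hb := hx ((le_max_right R₁ R₂).trans (hρ.trans hxA.1))
      rw [hFx, Real.norm_of_nonneg (by positivity)]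
      have e1 : ‖x‖ ^ 2 ≤ (2 * ρ) ^ 2 := by gcongr; exact hxA.2
      have e2 : ψ x ^ 2 ≤ C₂ * ψ x := by rw [sq]; gcongr
      calc ‖x‖ ^ 2 * ψ x ^ 2 ≤ (2 * ρ) ^ 2 * (C₂ * ψ x) := by gcongr
        _ = _ := by ring
    have hint : IntegrableOn F (annulus N ρ) volume :=
      (hψi.const_mul (4 * ρ ^ 2 * C₂)).mono' hFm.restrict hle
    refine ⟨hint, ?_⟩
    calc ∫ x in annulus N ρ, ‖F x‖ ≤ ∫ x in annulus N ρ, 4 * ρ ^ 2 * C₂ * ψ x :=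
          integral_mono_ae hint.norm (hψi.const_mul _) hle
      _ = 4 * ρ ^ 2 * C₂ * ∫ x in annulus N ρ, ψ x := integral_const_mul _ _
      _ ≤ 4 * ρ ^ 2 * C₂ * (C₁ * ρ ^ (-3 : ℝ)) := by
          gcongr
          exact h1 ρ ((le_max_left _ _).trans hρ)
      _ = 4 * C₂ * C₁ * ρ⁻¹ := by
          have : ρ ^ (-3 : ℝ) = (ρ ^ 3)⁻¹ := by
            rw [Real.rpow_neg hρ0.le]; norm_cast
          rw [this]
          field_simp
  have hρn : ∀ n : ℕ, R ≤ R * 2 ^ n := fun n =>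
    le_mul_of_one_le_right (by linarith) (one_le_pow₀ (by norm_num))
  have hunion : IntegrableOn F (⋃ n : ℕ, annulus N (R * 2 ^ n)) volume := by
    refine integrableOn_iUnion_of_summable_integral_norm
      (fun n => (hann _ (hρn n)).1) ?_
    refine Summable.of_nonneg_of_le (fun n => integral_nonneg fun x => norm_nonneg _)
      (fun n => (hann _ (hρn n)).2) ?_
    have : Summable fun n : ℕ => (4 * C₂ * C₁ * R⁻¹) * (1 / 2 : ℝ) ^ n :=
      summable_geometric_two.mul_left _
    refine this.congr fun n => ?_
    rw [mul_inv, one_div, inv_pow]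
    ring
  rw [← integrableOn_univ]
  refine (hball.union hunion).mono_set fun x _ => ?_
  by_cases hx : ‖x‖ ≤ R
  · left; simpa using hx
  · right
    rw [not_le] at hx
    obtain ⟨n, hn1, hn2⟩ := exists_nat_pow_near (x := ‖x‖ / R) (y := 2)
      ((one_le_div (by linarith)).2 hx.le) (by norm_num)
    rw [le_div_iff₀ (by linarith)] at hn1
    rw [div_lt_iff₀ (by linarith), pow_succ] at hn2
    refine Set.mem_iUnion.2 ⟨n, ?_, ?_⟩ <;> linarith

end Decay

/-- With zero gradient the Laplacian term drops out, leaving `|x|^{-b} ψ^{(4-2b)/N} = 1` almost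
everywhere. Then `ψ ≥ 1` outside the unit ball, which has infinite measure, contradicting `ψ ∈ L²`.
-/
theorem IsGroundState.l2Norm_gradient_pos {b : ℝ} {ψ : Space N → ℝ} (hN : 1 ≤ N) (hb0 : 0 < b)
    (hb2 : b < 2) (hψ : IsGroundState b ψ) {g : Space N → EuclideanSpace ℂ (Fin N)}
    (hg : MemLp g 2 volume) (h : HasWeakGradient (fun x => (ψ x : ℂ)) g) : 0 < l2Norm g := by
  refine (l2Norm_nonneg g).lt_of_ne' fun h0 => ?_
  have hlc : LocallyIntegrable (fun x => (ψ x : ℂ)) volume :=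
    locallyIntegrable_of_memLp_two hψ.memH1.1
  have hg0 : g =ᵐ[volume] 0 := by
    unfold l2Norm at h0
    rw [ENNReal.toReal_eq_zero_iff] at h0
    exact (eLpNorm_eq_zero_iff hg.1 (by norm_num)).1 (h0.resolve_right hg.2.ne)
  have hlap : ∀ η : Space N → ℂ, IsTestFunction η →
      ∫ x, (ψ x : ℂ) * Laplacian.laplacian η x = 0 := by
    intro η hη
    have e : ∀ x, (ψ x : ℂ) * Laplacian.laplacian η x = ∑ i : Fin N, (ψ x : ℂ) *
        fderiv ℝ (fun y => fderiv ℝ η y (EuclideanSpace.single i 1)) x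
          (EuclideanSpace.single i 1) := fun x => by
      rw [laplacian_eq_sum (contDiff_infty.1 hη.1 2), Finset.mul_sum]
    simp only [e]
    rw [integral_finsetSum _ fun i _ => integrable_mul_test hlc ((hη.fderiv_apply _).fderiv_apply _)]
    refine Finset.sum_eq_zero fun i _ => ?_
    rw [h _ (hη.fderiv_apply _) i, neg_eq_zero]
    refine integral_eq_zero_of_ae ?_
    filter_upwards [hg0] with x hx
    simp [hx]
  have hae : ∀ᵐ x : Space N, nonlin b (fun x => (ψ x : ℂ)) x = (ψ x : ℂ) := by
    refine ae_eq_of_integral_contDiff_smul_eq hψ.locallyIntegrable_nonlin hlc fun θ hθ hc => ?_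
    have ht := isTestFunction_ofReal hθ hc
    have h1 := hψ.equation _ ht
    rw [hlap _ ht, zero_sub] at h1
    simp only [Complex.real_smul]
    simp only [mul_comm] at h1 ⊢
    linear_combination h1
  have hge : ∀ᵐ x : Space N, 1 ≤ ‖x‖ → 1 ≤ ψ x := by
    filter_upwards [hae] with x hx h1
    have hp := hψ.pos x
    rw [nonlin_ofReal hψ] at hx
    have hx2 := Complex.ofReal_injective hx
    have hx3 : ‖x‖ ^ (-b) * ψ x ^ ((4 - 2 * b) / (N : ℝ)) = 1 := mul_right_cancel₀ hp.ne'
      (hx2.trans (one_mul _).symm)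
    by_contra hlt
    rw [not_le] at hlt
    have hN' : (0 : ℝ) < N := by exact_mod_cast hN
    have a1 : ‖x‖ ^ (-b) ≤ 1 := Real.rpow_le_one_of_one_le_of_nonpos h1 (by linarith)
    have a2 : ψ x ^ ((4 - 2 * b) / (N : ℝ)) < 1 :=
      Real.rpow_lt_one hp.le hlt (div_pos (by linarith) hN')
    have a3 : 0 ≤ ψ x ^ ((4 - 2 * b) / (N : ℝ)) := by positivity
    have a4 : 0 ≤ ‖x‖ ^ (-b) := by positivity
    nlinarith
  have := nontrivial_space hN
  have hfin := hψ.memLp.meas_ge_lt_top (by norm_num) (by norm_num) (ε := 1) one_ne_zero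
  have hsub : (Metric.closedBall (0 : Space N) 1)ᶜ ≤ᵐ[volume] {x | (1 : NNReal) ≤ ‖ψ x‖₊} := by
    filter_upwards [hge] with x hx hxc
    have h1 : 1 < ‖x‖ := by
      have hxc' : x ∈ (Metric.closedBall (0 : Space N) 1)ᶜ := hxc
      simpa using hxc'
    have h2 := hx h1.le
    change (1 : NNReal) ≤ ‖ψ x‖₊
    rw [← NNReal.coe_le_coe, coe_nnnorm, Real.norm_of_nonneg (hψ.pos x).le]
    exact h2
  have h3 := (measure_mono_ae hsub).trans_lt hfin
  have h4 : (volume : Measure (Space N)) Set.univ < ⊤ := by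
    rw [← Set.union_compl_self (Metric.closedBall (0 : Space N) 1)]
    exact (measure_union_le _ _).trans_lt (ENNReal.add_lt_top.2 ⟨measure_closedBall_lt_top, h3⟩)
  rw [measure_univ_of_isAddLeftInvariant] at h4
  exact lt_irrefl _ h4

end INLS

theorem proposition5p2 (N : ℕ) (hN : 1 ≤ N) (b : ℝ) (hb0 : 0 < b) (hb : b < min 2 (N : ℝ))
    (ψ : INLS.Space N → ℝ) (hψ : INLS.IsGroundState b ψ)
    (T lam0 gam0 : ℝ) (hlam0 : 0 < lam0) :
    INLS.IsSolutionOn b (Set.Iio T) (INLS.S ψ T lam0 gam0) ∧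
    (∀ t < T, INLS.l2Norm (INLS.S ψ T lam0 gam0 t) = INLS.l2Norm ψ) ∧
    ∃ C : ℝ, 0 < C ∧
      (fun t => INLS.l2Norm (INLS.weakGrad (INLS.S ψ T lam0 gam0 t)))
        ~[𝓝[<] T] (fun t => C / (T - t)) := by
  have hb2 : b < 2 := hb.trans_le (min_le_left _ _)
  have hx := hψ.memLp_firstMoment hN hb0 hb2
  obtain ⟨h2, g, hg, hgrad⟩ := hψ.memH1
  have hpos := hψ.l2Norm_gradient_pos hN hb0 hb2 hg hgrad
  exact ⟨hψ.isSolutionOn_S hN hx gam0 hlam0, fun t ht => INLS.l2Norm_S ψ gam0 hlam0 ht,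
    lam0 * INLS.l2Norm g, mul_pos hlam0 hpos,
    INLS.isEquivalent_l2Norm_weakGrad_S h2 hg hgrad hx hlam0 hpos⟩
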